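/- Let $N\in\mathbb{N}_0$, let $x_1<\dots<x_N$ be real numbers, and let $\omega=\sum_{n=1}^N\omega_n\delta_{x_n}$, $\upsilon=\sum_{n=1}^N\upsilon_n\delta_{x_n}$ be discrete measures with $\omega_n\in\mathbb{R}$, $\upsilon_n\ge 0$ and $|\omega_n|+\upsilon_n>0$ for all $n$. For $z\in\mathbb{C}$ consider the equation $$-f''+\tfrac14 f=z\,\omega f+z^2\upsilon f\quad\text{on }\mathbb{R},$$ that is, $f$ is continuous, $-f''+\frac14 f=0$ away from the points $x_n$, and $f'(x_n-)=(z\omega_n+z^2\upsilon_n)f(x_n)+f'(x_n+)$ for $n=1,\dots,N$. The spectrum $\sigma$ is the set of all $z\in\mathbb{C}$ for which there is a nontrivial bounded solution. Let $\phi_+(z,\cdot)$ be the solution with $\phi_+(z,x)=\mathrm{e}^{-x/2}$ for all $x$ near $+\infty$ and, for $\lambda\in\sigma$, let $$\gamma_\lambda^2=\int_{\mathbb{R}}|\phi_+(\lambda,x)|^2\,d\omega(x)+2\lambda\int_{\mathbb{R}}|\phi_+(\lambda,x)|^2\,d\upsilon(x).$$ Then $\sigma$ is a finite subset of $\mathbb{R}$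 and $\lambda\gamma_\lambda^2>0$ for every $\lambda\in\sigma$. Define the moments $$s_{-1}=0,\qquad s_0=1+\sum_{\lambda\in\sigma}\frac{1}{\lambda\gamma_\lambda^2},\qquad s_k=\sum_{\lambda\in\sigma}\frac{\lambda^k}{\lambda\gamma_\lambda^2}\quad(k\ge1),$$ and the Hankel determinants $\Delta_{i,k}=\det\big(s_{i+a+b}\big)_{0\le a,b\le k-1}$ for $i\in\{-1,0,1,2\}$, where $\Delta_{i,0}=1$. Let $|\sigma|$ be the number of eigenvalues and $\kappa_0$ the number of zeros among $\Delta_{1,1},\dots,\Delta_{1,|\sigma|}$. For $n=0,\dots,N$ let $\kappa(n)$ be the largest integer $k\in\{0,\dots,|\sigma|\}$ such that exactly $n+1$ of the numbers $\Delta_{1,k},\dots,\Delta_{1,|\sigma|}$ are nonzero. Then $N=|\sigma|-\kappa_0$ and, for each $n\in\{1,\dots,N\}$, $$x_n=\log\left(\frac{\Delta_{0,\kappa(n)+1}}{\Delta_{2,\kappa(n)}}-1\right).$$ If $\Delta_{1,\kappa(n)+1}\ne0$, then $$\omega_n=\frac{\Delta_{2,\kappa(n)}\big(\Delta_{0,\kappa(n)+1}-\Delta_{2,\kappa(n)}\big)}{\Delta_{1,\kappa(n)}\,\Delta_{1,\kappa(n)+1}},\qquad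 \upsilon_n=0,$$ and if $\Delta_{1,\kappa(n)+1}=0$, then $$\omega_n=\frac{\Delta_{2,\kappa(n)}\big(\Delta_{0,\kappa(n)+1}-\Delta_{2,\kappa(n)}\big)}{\Delta_{0,\kappa(n)+1}^2}\left(\frac{\Delta_{-1,\kappa(n)+1}}{\Delta_{1,\kappa(n)}}-\frac{\Delta_{-1,\kappa(n)+3}}{\Delta_{1,\kappa(n)+2}}\right),$$ $$\upsilon_n=-\frac{\Delta_{0,\kappa(n)+2}}{\Delta_{0,\kappa(n)+1}}\cdot\frac{\Delta_{2,\kappa(n)}\big(\Delta_{0,\kappa(n)+1}-\Delta_{2,\kappa(n)}\big)}{\Delta_{1,\kappa(n)}\,\Delta_{1,\kappa(n)+2}}.$$ Here $\Delta_{0,\kappa(n)+1}$, $\Delta_{2,\kappa(n)}$ and the argument of the logarithm are positive, $\Delta_{1,\kappa(n)}\ne0$, and $\Delta_{1,\kappa(n)+2}\ne0$ whenever $\Delta_{1,\kappa(n)+1}=0$. -/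

import Mathlib

open Filter Topology

noncomputable section

namespace PeakonString

/-- A pair of finite discrete measures `ω = ∑ ωₙ δ_{xₙ}` and `υ = ∑ υₙ δ_{xₙ}` on the real line with
strictly increasing points `x₁ < ⋯ < x_N`, real weights `ωₙ`, non-negative weights `υₙ`, and
`supp (|ω| + υ) = {x₁, …, x_N}`.  The index `n ∈ {1, …, N}` is represented by `Fin N`, starting
at zero.  The case `N = 0` (both measures vanish) is allowed. -/
structure DiscretePair where
  N : ℕ
  x : Fin N → ℝ
  ω : Fin N → ℝ
  υ : Fin N → ℝ
  strictMono_x : StrictMono x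
  υ_nonneg : ∀ n, 0 ≤ υ n
  weight_pos : ∀ n, 0 < |ω n| + υ n

namespace DiscretePair

variable (P : DiscretePair)

/-- The integral of `g` with respect to the discrete signed measure `ω`. -/
def integralω (g : ℝ → ℝ) : ℝ := ∑ n, P.ω n * g (P.x n)

/-- The integral of `g` with respect to the discrete measure `υ`. -/
def integralυ (g : ℝ → ℝ) : ℝ := ∑ n, P.υ n * g (P.x n)

/-- `f` is a solution of `-f'' + f / 4 = z ω f + z² υ f`: it is continuous, satisfies
`-f'' + f / 4 = 0` away from the points `xₙ`, and at each `xₙ` the one-sided limits of `f'` exist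
with `f'(xₙ-) = (z ωₙ + z² υₙ) f(xₙ) + f'(xₙ+)`. -/
structure IsSolution (z : ℂ) (f : ℝ → ℂ) : Prop where
  continuous : Continuous f
  differentiableAt : ∀ t, t ∉ Set.range P.x → DifferentiableAt ℝ f t
  ode : ∀ t, t ∉ Set.range P.x → HasDerivAt (deriv f) (f t / 4) t
  jump : ∀ n, ∃ a b : ℂ, Tendsto (deriv f) (𝓝[<] (P.x n)) (𝓝 a) ∧
    Tendsto (deriv f) (𝓝[>] (P.x n)) (𝓝 b) ∧
    a = (z * (P.ω n : ℂ) + z ^ 2 * (P.υ n : ℂ)) * f (P.x n) + b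

/-- The spectrum: all complex `z` for which there is a nontrivial bounded solution. -/
def spectrum : Set ℂ :=
  {z | ∃ f : ℝ → ℂ, P.IsSolution z f ∧ f ≠ 0 ∧ ∃ C : ℝ, ∀ t, ‖f t‖ ≤ C}

/-- The values at the points `xₙ` of the solution that equals `exp (-t / 2)` near `+∞`. -/
def nodeValue (z : ℂ) (n : Fin P.N) : ℂ :=
  Complex.exp (-(P.x n : ℂ) / 2) + ∑ m : Fin P.N, if _h : n < m then
    (z * (P.ω m : ℂ) + z ^ 2 * (P.υ m : ℂ)) * nodeValue z m *
      (2 * Complex.sinh (((P.x n : ℂ) - (P.x m : ℂ)) / 2)) else 0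
termination_by P.N - n.val
decreasing_by have := m.isLt; have : n.val < m.val := _h; omega

/-- The (unique) solution exists: this is the justification of the definition of `phiPlus`. -/
theorem exists_phiPlus (z : ℂ) : ∃ f : ℝ → ℂ, P.IsSolution z f ∧
    ∀ᶠ t : ℝ in atTop, f t = Complex.exp (-(t : ℂ) / 2) := by
  classical
  set c : Fin P.N → ℂ := fun m =>
    (z * (P.ω m : ℂ) + z ^ 2 * (P.υ m : ℂ)) * P.nodeValue z m with hc
  let f : ℝ → ℂ := fun t => Complex.exp (-(t : ℂ) / 2) +
    ∑ m, c m * (2 * Complex.sinh (((min (t - P.x m) 0 : ℝ) : ℂ) / 2))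
  have hnode : ∀ n, f (P.x n) = P.nodeValue z n := by
    intro n
    rw [nodeValue]
    simp only [f]
    congr 1
    refine Finset.sum_congr rfl fun m _ => ?_
    by_cases h : n < m
    · have hlt := P.strictMono_x h
      rw [dif_pos h, min_eq_left (by linarith)]
      push_cast
      rfl
    · have hle : P.x m ≤ P.x n := P.strictMono_x.monotone (not_lt.1 h)
      rw [dif_neg h, min_eq_right (by linarith)]
      simp
  -- smooth branches
  let F : Finset (Fin P.N) → ℝ → ℂ := fun S t => Complex.exp (-(t : ℂ) / 2) +
    ∑ m ∈ S, c m * (2 * Complex.sinh (((t : ℂ) - (P.x m : ℂ)) / 2))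
  let F' : Finset (Fin P.N) → ℝ → ℂ := fun S t => -Complex.exp (-(t : ℂ) / 2) / 2 +
    ∑ m ∈ S, c m * Complex.cosh (((t : ℂ) - (P.x m : ℂ)) / 2)
  have hF : ∀ S t, HasDerivAt (F S) (F' S t) t := by
    intro S t
    have h1 := hasDerivAt_id (t : ℂ)
    refine HasDerivAt.add ?_ (HasDerivAt.fun_sum fun m _ => ?_)
    · have := (h1.neg.div_const 2).cexp.comp_ofReal
      refine this.congr_deriv ?_
      simp
      ring
    · have := ((((h1.sub_const (P.x m : ℂ)).div_const 2).csinh.const_mul 2).const_mul (c m)).comp_ofReal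
      refine this.congr_deriv ?_
      simp
      left
      ring
  have hF' : ∀ S t, HasDerivAt (F' S) (F S t / 4) t := by
    intro S t
    have h1 := hasDerivAt_id (t : ℂ)
    have e : F S t / 4 = Complex.exp (-(t : ℂ) / 2) / 4 +
        ∑ m ∈ S, c m * (Complex.sinh (((t : ℂ) - (P.x m : ℂ)) / 2) / 2) := by
      simp only [F, add_div, Finset.sum_div]
      congr 1
      exact Finset.sum_congr rfl fun m _ => by ring
    rw [e]
    refine HasDerivAt.add ?_ (HasDerivAt.fun_sum fun m _ => ?_)
    · have := ((h1.neg.div_const 2).cexp.neg.div_const 2).comp_ofReal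
      refine this.congr_deriv ?_
      simp
      ring
    · have := (((h1.sub_const (P.x m : ℂ)).div_const 2).ccosh.const_mul (c m)).comp_ofReal
      refine this.congr_deriv ?_
      simp
      left
      ring
  have hbranch : ∀ (S : Finset (Fin P.N)) (t : ℝ), (∀ m ∈ S, t ≤ P.x m) →
      (∀ m ∉ S, P.x m ≤ t) → f t = F S t := by
    intro S t h1 h2
    simp only [f, F]
    congr 1
    rw [← Finset.sum_subset (Finset.subset_univ S)]
    · refine Finset.sum_congr rfl fun m hm => ?_
      rw [min_eq_left (by linarith [h1 m hm])]
      push_cast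
      rfl
    · intro m _ hm
      rw [min_eq_right (by linarith [h2 m hm])]
      simp
  have hderiv : ∀ (S : Finset (Fin P.N)) (U : Set ℝ), IsOpen U →
      (∀ t ∈ U, (∀ m ∈ S, t ≤ P.x m) ∧ (∀ m ∉ S, P.x m ≤ t)) →
      ∀ t ∈ U, HasDerivAt f (F' S t) t := by
    intro S U hU h t ht
    refine (hF S t).congr_of_eventuallyEq ?_
    filter_upwards [hU.mem_nhds ht] with s hs using hbranch S s (h s hs).1 (h s hs).2
  -- neighbourhoods on which the branch is fixed
  have hL : ∀ a : ℝ, ∃ l < a, ∀ m, P.x m < a → P.x m ≤ l := by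
    intro a
    have : ∀ᶠ l in 𝓝[<] a, ∀ m, P.x m < a → P.x m ≤ l := by
      rw [eventually_all]
      intro m
      by_cases h : P.x m < a
      · filter_upwards [Ioo_mem_nhdsLT h] with l hl _ using hl.1.le
      · exact Eventually.of_forall fun l h' => absurd h' h
    obtain ⟨l, h1, h2⟩ := (this.and self_mem_nhdsWithin).exists
    exact ⟨l, h2, h1⟩
  have hR : ∀ a : ℝ, ∃ r > a, ∀ m, a < P.x m → r ≤ P.x m := by
    intro a
    have : ∀ᶠ r in 𝓝[>] a, ∀ m, a < P.x m → r ≤ P.x m := by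
      rw [eventually_all]
      intro m
      by_cases h : a < P.x m
      · filter_upwards [Ioo_mem_nhdsGT h] with l hl _ using hl.2.le
      · exact Eventually.of_forall fun l h' => absurd h' h
    obtain ⟨l, h1, h2⟩ := (this.and self_mem_nhdsWithin).exists
    exact ⟨l, h2, h1⟩
  have hoff : ∀ t, t ∉ Set.range P.x → ∃ (S : Finset (Fin P.N)) (U : Set ℝ), IsOpen U ∧ t ∈ U ∧
      ∀ t ∈ U, (∀ m ∈ S, t ≤ P.x m) ∧ (∀ m ∉ S, P.x m ≤ t) := by
    intro t ht
    obtain ⟨l, hl, hl'⟩ := hL t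
    obtain ⟨r, hr, hr'⟩ := hR t
    refine ⟨Finset.univ.filter fun m => t < P.x m, Set.Ioo l r, isOpen_Ioo, ⟨hl, hr⟩, ?_⟩
    intro s hs
    refine ⟨fun m hm => ?_, fun m hm => ?_⟩
    · exact hs.2.le.trans (hr' m (by simpa using hm))
    · have h1 : P.x m ≤ t := by simpa using hm
      have h2 : P.x m < t := lt_of_le_of_ne h1 fun h => ht ⟨m, h⟩
      exact (hl' m h2).trans hs.1.le
  refine ⟨f, ⟨?_, ?_, ?_, ?_⟩, ?_⟩
  · simp only [f]
    fun_prop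
  · intro t ht
    obtain ⟨S, U, hU, htU, h⟩ := hoff t ht
    exact (hderiv S U hU h t htU).differentiableAt
  · intro t ht
    obtain ⟨S, U, hU, htU, h⟩ := hoff t ht
    rw [hbranch S t (h t htU).1 (h t htU).2]
    refine (hF' S t).congr_of_eventuallyEq ?_
    filter_upwards [hU.mem_nhds htU] with s hs using (hderiv S U hU h s hs).deriv
  · intro n
    obtain ⟨l, hl, hl'⟩ := hL (P.x n)
    obtain ⟨r, hr, hr'⟩ := hR (P.x n)
    refine ⟨F' (Finset.Ici n) (P.x n), F' (Finset.Ioi n) (P.x n), ?_, ?_, ?_⟩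
    · refine Tendsto.congr' ?_
        ((hF' (Finset.Ici n) (P.x n)).continuousAt.tendsto.mono_left nhdsWithin_le_nhds)
      filter_upwards [Ioo_mem_nhdsLT hl] with s hs
      refine (hderiv (Finset.Ici n) (Set.Ioo l (P.x n)) isOpen_Ioo ?_ s hs).deriv.symm
      intro t ht
      refine ⟨fun m hm => ?_, fun m hm => ?_⟩
      · exact ht.2.le.trans (P.strictMono_x.monotone (by simpa using hm))
      · exact (hl' m (P.strictMono_x (by simpa using hm))).trans ht.1.le
    · refine Tendsto.congr' ?_
        ((hF' (Finset.Ioi n) (P.x n)).continuousAt.tendsto.mono_left nhdsWithin_le_nhds)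
      filter_upwards [Ioo_mem_nhdsGT hr] with s hs
      refine (hderiv (Finset.Ioi n) (Set.Ioo (P.x n) r) isOpen_Ioo ?_ s hs).deriv.symm
      intro t ht
      refine ⟨fun m hm => ?_, fun m hm => ?_⟩
      · exact ht.2.le.trans (hr' m (P.strictMono_x (by simpa using hm)))
      · exact (P.strictMono_x.monotone (by simpa using hm)).trans ht.1.le
    · have h1 : Finset.Ici n = insert n (Finset.Ioi n) := by
        ext m; simp [le_iff_eq_or_lt]
      rw [hnode n]
      simp only [F']
      rw [h1, Finset.sum_insert (by simp)]
      simp only [sub_self, zero_div, Complex.cosh_zero, hc]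
      ring
  · have : ∀ᶠ t : ℝ in atTop, ∀ m, P.x m ≤ t := by
      rw [eventually_all]
      exact fun m => eventually_ge_atTop (P.x m)
    filter_upwards [this] with t ht
    rw [hbranch ∅ t (by simp) (fun m _ => ht m)]
    simp [F]

/-- `φ₊(z, ·)`: the solution that equals `exp (-t / 2)` for all `t` near `+∞`. -/
def phiPlus (z : ℂ) : ℝ → ℂ := (P.exists_phiPlus z).choose

/-- The (modified) norming constant `γ_l² = ∫ |φ₊(l, ·)|² dω + 2 l ∫ |φ₊(l, ·)|² dυ`. -/
def gammaSq (l : ℝ) : ℝ :=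
  P.integralω (fun t => ‖P.phiPlus l t‖ ^ 2) + 2 * l * P.integralυ (fun t => ‖P.phiPlus l t‖ ^ 2)

/-- The number `|σ|` of eigenvalues. -/
def numEigenvalues : ℕ := P.spectrum.ncard

/-- The sum `∑_{l ∈ σ} l ^ k / (l γ_l²)`; the spectrum is real and finite. -/
def spectralSum (k : ℕ) : ℝ :=
  ∑ᶠ (l : ℝ) (_ : (l : ℂ) ∈ P.spectrum), l ^ k / (l * P.gammaSq l)

/-- The moments: `s₋₁ = 0`, `s₀ = 1 + ∑ 1 / (l γ_l²)` and `s_k = ∑ l ^ k / (l γ_l²)` for `k ≥ 1`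
(indices below `-1` never occur). -/
def moment (k : ℤ) : ℝ :=
  if k < 0 then 0 else if k = 0 then 1 + P.spectralSum 0 else P.spectralSum k.toNat

/-- The Hankel determinant `Δ_{i,k} = det (s_{i+a+b})` with `0 ≤ a, b < k`; it is `1` for
`k = 0`. -/
def hankelDet (i : ℤ) (k : ℕ) : ℝ :=
  (Matrix.of fun a b : Fin k => P.moment (i + (a.val : ℤ) + (b.val : ℤ))).det

open Classical in
/-- The number `κ₀` of zero elements among `Δ_{1,1}, …, Δ_{1,|σ|}`. -/
def kappaZero : ℕ := ((Finset.Icc 1 P.numEigenvalues).filter fun j => P.hankelDet 1 j = 0).card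

open Classical in
/-- `κ(n)`: the largest integer `k` in `{0, …, |σ|}` such that the number of nonzero elements of
`Δ_{1,k}, …, Δ_{1,|σ|}` is exactly `n + 1`. -/
def kappa (n : ℕ) : ℕ :=
  Nat.findGreatest
    (fun k => ((Finset.Icc k P.numEigenvalues).filter fun j => P.hankelDet 1 j ≠ 0).card = n + 1)
    P.numEigenvalues

end DiscretePair

end PeakonString

end

/-! Put ξ = exp x and f = exp(-x/2) F. Then F is affine in ξ between the points, and the equation
becomes a string on (0, ∞) with finitely many masses and dipoles. The solution `phiPlus` becomes the
right solution `ra + rb ξ`, whose coefficients are polynomials in z. Boundedness at -∞ says that its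
constant term to the left of all points vanishes, so σ is the zero set of χ = `charPoly`. Summation
by parts (`exists_energy`) makes σ real and λγ² positive. The identity γ² = -χ'(λ) rb₀(λ)
(`norming_eq`) makes the zeros simple, so |σ| = deg χ.

Number the points from zero and let Fₙ = `rnode n`, Gₙ = `lnode n` be the values at the n-th point
of the right solution and of the left solution (equal to ξ near 0). At an eigenvalue Gₙ is the
multiple of Fₙ by 1/rb₀, hence Fₙ(λ)/γ² = -Gₙ(λ)/χ'(λ). Lagrange interpolation at the zeros of χ
evaluates sums of p(λ)/χ'(λ) and p(λ)/(λχ'(λ)) for deg p < deg χ as the top coefficient of p divided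
by that of χ, and as -p(0). Therefore Fₙ, with Fₙ(0) = 1 and degree at most k = `rdeg (n + 1)`,
satisfies explicit orthogonality relations for the moments (`functional_rnode_eq_zero`,
`functional_rnode_top`, `functional_mom_one_rnode`).

Cramer's rule turns these relations into Hankel determinants. They give Δ_{0,k+1} = (1 + ξₙ)
Δ_{2,k}, hence the position, and show that Δ_{1,m} ≠ 0 for m ≤ |σ| exactly when m is one of the
degrees `rdeg j`, hence κ(j) = `rdeg j`. A mass raises the degree by one and a dipole by two, which
is the case distinction on Δ_{1,k+1}. The leading weight at a point follows from top coefficients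
(`lead_eq`). At a dipole that is only υₙ; there ωₙ comes from the jump of `ra - rb`, the affine
pieces continued to ξ = -1, tested against the moments starting with s₋₁ (`hank_zero_rdeg`,
`functional_mom_sub`). -/

noncomputable section

/-! ### Hankel determinants and moment functionals. -/

namespace Hankel

open Polynomial Matrix

/-- The Hankel matrix `(s (a + b))` of size `m`. -/
def mat (s : ℕ → ℝ) (m : ℕ) : Matrix (Fin m) (Fin m) ℝ := Matrix.of fun a b => s (a + b)

/-- The Hankel determinant of size `m`. -/
def hdet (s : ℕ → ℝ) (m : ℕ) : ℝ := (mat s m).det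

/-- The linear functional on polynomials with moments `s`. -/
def functional (s : ℕ → ℝ) : ℝ[X] →ₗ[ℝ] ℝ := Polynomial.lsum fun k => LinearMap.lsmul ℝ ℝ (s k)

theorem functional_eq_sum (s : ℕ → ℝ) {p : ℝ[X]} {m : ℕ} (hp : p.natDegree < m) :
    functional s p = ∑ k ∈ Finset.range m, s k * p.coeff k := by
  simp only [functional, Polynomial.lsum_apply]
  rw [Polynomial.sum_over_range' _ (by simp) m hp]
  simp

theorem functional_monomial (s : ℕ → ℝ) (k : ℕ) (r : ℝ) :
    functional s (monomial k r) = s k * r := by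
  simp [functional, Polynomial.lsum_apply, Polynomial.sum_monomial_index]

theorem functional_mul_X_pow (s : ℕ → ℝ) (p : ℝ[X]) (a : ℕ) :
    functional s (p * X ^ a) = functional (fun k => s (k + a)) p := by
  induction p using Polynomial.induction_on' with
  | add p q hp hq => rw [add_mul, map_add, map_add, hp, hq]
  | monomial n r => rw [monomial_mul_X_pow, functional_monomial, functional_monomial]

theorem functional_eq_of_eval {ι : Type*} (S : Finset ι) (w l : ι → ℝ) (p : ℝ[X]) :
    functional (fun k => ∑ i ∈ S, w i * l i ^ k) p = ∑ i ∈ S, w i * p.eval (l i) := by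
  induction p using Polynomial.induction_on' with
  | add p q hp hq =>
    rw [map_add, hp, hq, ← Finset.sum_add_distrib]
    exact Finset.sum_congr rfl fun i _ => by rw [eval_add]; ring
  | monomial n r =>
    rw [functional_monomial, Finset.sum_mul]
    exact Finset.sum_congr rfl fun i _ => by rw [eval_monomial]; ring

/-- The coefficients of `p` as a vector. -/
def coeffVec (p : ℝ[X]) (m : ℕ) : Fin m → ℝ := fun b => p.coeff b

theorem mat_mulVec (s : ℕ → ℝ) {p : ℝ[X]} {m : ℕ} (hp : p.natDegree < m) (a : Fin m) :
    (mat s m *ᵥ coeffVec p m) a = functional s (p * X ^ (a : ℕ)) := by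
  rw [functional_mul_X_pow, functional_eq_sum _ hp, ← Fin.sum_univ_eq_sum_range
    (fun k => s (k + a) * p.coeff k)]
  simp [mulVec, dotProduct, mat, coeffVec, add_comm]

/-- Cramer's rule in adjugate form. Invertibility is not assumed, since it is applied to Hankel
matrices that may be singular. -/
theorem mul_det_of_mulVec_eq_single {m : ℕ} (A : Matrix (Fin (m + 1)) (Fin (m + 1)) ℝ)
    (v : Fin (m + 1) → ℝ) (i : Fin (m + 1)) (t : ℝ) (h : A *ᵥ v = Pi.single i t)
    (j : Fin (m + 1)) :
    v j * A.det = (-1) ^ (i + j : ℕ) * t * (A.submatrix i.succAbove j.succAbove).det := by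
  have h1 : A.adjugate *ᵥ (A *ᵥ v) = A.det • v := by
    rw [mulVec_mulVec, adjugate_mul, smul_mulVec, one_mulVec]
  have h2 := congrFun h1 j
  rw [h, mulVec_single] at h2
  simp only [col_apply, Pi.smul_apply, smul_eq_mul, adjugate_fin_succ_eq_det_submatrix,
    MulOpposite.smul_eq_mul_unop, MulOpposite.unop_op] at h2
  rw [mul_comm, ← h2]
  ring

/-- By orthogonality the Hankel matrix sends the coefficient vector of `p` to a multiple of the
first unit vector. Deleting the first row and column raises the moment index by two. -/
theorem coeff_zero_mul_hdet_succ (s : ℕ → ℝ) {p : ℝ[X]} {m : ℕ} (hp : p.natDegree ≤ m)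
    (h : ∀ a, 1 ≤ a → a ≤ m → functional s (p * X ^ a) = 0) :
    p.coeff 0 * hdet s (m + 1) = functional s p * hdet (fun k => s (k + 2)) m := by
  have := mul_det_of_mulVec_eq_single (mat s (m + 1)) (coeffVec p (m + 1)) 0 (functional s p) ?_ 0
  · simp only [coeffVec, Fin.val_zero, add_zero, pow_zero, one_mul] at this
    rw [hdet, this, hdet]
    congr 2
    ext a b
    simp only [mat, submatrix_apply, of_apply, Fin.succAbove_zero, Fin.val_succ]
    congr 1
    omega
  · funext a
    rw [mat_mulVec s (by omega)]
    rcases eq_or_ne a 0 with rfl | ha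
    · simp
    · rw [Pi.single_eq_of_ne ha]
      exact h a (Nat.one_le_iff_ne_zero.2 fun h0 => ha (Fin.ext h0)) (Nat.lt_succ_iff.1 a.2)

/-- Here the image is a multiple of the last unit vector. Deleting the last row and the first column
raises the moment index by one. -/
theorem coeff_zero_mul_hdet_succ_of_orthogonal (s : ℕ → ℝ) {p : ℝ[X]} {m : ℕ}
    (hp : p.natDegree ≤ m) (h : ∀ a < m, functional s (p * X ^ a) = 0) :
    p.coeff 0 * hdet s (m + 1) =
      (-1) ^ m * functional s (p * X ^ m) * hdet (fun k => s (k + 1)) m := by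
  have := mul_det_of_mulVec_eq_single (mat s (m + 1)) (coeffVec p (m + 1)) (Fin.last m)
    (functional s (p * X ^ m)) ?_ 0
  · simp only [coeffVec, Fin.val_zero, add_zero, Fin.val_last] at this
    rw [hdet, this, hdet]
    congr 2
    ext a b
    simp only [mat, submatrix_apply, of_apply, Fin.succAbove_zero, Fin.val_succ,
      Fin.succAbove_last, Fin.val_castSucc]
    congr 1
  · funext a
    rw [mat_mulVec s (by omega)]
    rcases eq_or_ne a (Fin.last m) with rfl | ha
    · simp
    · rw [Pi.single_eq_of_ne ha]
      exact h a (Fin.val_lt_last ha)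

theorem coeff_mul_hdet_shift (s : ℕ → ℝ) {p : ℝ[X]} {m : ℕ}
    (hp : p.natDegree ≤ m) (h : ∀ a < m, functional s (p * X ^ a) = 0) :
    p.coeff m * hdet (fun k => s (k + 1)) m = (-1) ^ m * p.coeff 0 * hdet s m := by
  -- The last row, the only one not controlled by orthogonality, is replaced by the functional that
  -- reads off `p.coeff 0`.
  set A := (mat s (m + 1)).updateRow (Fin.last m) (Pi.single 0 1) with hA
  have hAv : A *ᵥ coeffVec p (m + 1) = Pi.single (Fin.last m) (p.coeff 0) := by
    funext a
    rcases eq_or_ne a (Fin.last m) with rfl | ha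
    · simp [hA, mulVec, coeffVec]
    · rw [Pi.single_eq_of_ne ha]
      have : (A *ᵥ coeffVec p (m + 1)) a = (mat s (m + 1) *ᵥ coeffVec p (m + 1)) a := by
        simp [hA, mulVec, updateRow_ne ha]
      rw [this, mat_mulVec s (by omega)]
      exact h a (Fin.val_lt_last ha)
  have h1 := mul_det_of_mulVec_eq_single A _ _ _ hAv (Fin.last m)
  have h2 : A.det = (-1) ^ m * hdet (fun k => s (k + 1)) m := by
    rw [det_succ_row A (Fin.last m), Finset.sum_eq_single 0]
    · simp only [hA, updateRow_self, Pi.single_eq_same, Fin.val_last, Fin.val_zero, add_zero,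
        mul_one, hdet]
      congr 2
      ext a b
      simp only [submatrix_apply, Fin.succAbove_last, Fin.succAbove_zero]
      rw [updateRow_ne (Fin.castSucc_lt_last a).ne]
      simp only [mat, of_apply, Fin.val_castSucc, Fin.val_succ]
      congr 1
    · intro b _ hb
      simp [hA, Pi.single_eq_of_ne hb]
    · simp
  have h3 : (A.submatrix (Fin.last m).succAbove (Fin.last m).succAbove).det = hdet s m := by
    rw [hdet]
    congr 1
    ext a b
    simp only [hA, submatrix_apply, Fin.succAbove_last]
    rw [updateRow_ne (Fin.castSucc_lt_last a).ne]
    simp [mat]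
  rw [h2, h3] at h1
  simp only [coeffVec, Fin.val_last, Even.neg_pow ⟨m, rfl⟩, one_pow, one_mul] at h1
  have h4 : ((-1 : ℝ) ^ m) * (-1) ^ m = 1 := by rw [← mul_pow]; simp
  linear_combination (-1) ^ m * h1 - p.coeff m * hdet (fun k => s (k + 1)) m * h4

/-- The quadratic form of the Hankel matrix is the integral of p² against the discrete measure. A
nonzero p of degree below `m` cannot vanish at all the atoms. -/
theorem hdet_pos {ι : Type*} (S : Finset ι) (w l : ι → ℝ) (hw : ∀ i ∈ S, 0 < w i)
    (hl : Set.InjOn l S) {m : ℕ} (hm : m ≤ S.card) :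
    0 < hdet (fun k => ∑ i ∈ S, w i * l i ^ k) m := by
  classical
  refine Matrix.PosDef.det_pos (Matrix.PosDef.of_dotProduct_mulVec_pos ?_ ?_)
  · ext a b
    simp [mat, add_comm]
  · intro v hv
    set p : ℝ[X] := ∑ a : Fin m, C (v a) * X ^ (a : ℕ) with hp
    have hpe : ∀ t, p.eval t = ∑ a : Fin m, v a * t ^ (a : ℕ) := by
      intro t; simp [hp, eval_finsetSum]
    have key : star v ⬝ᵥ (mat (fun k => ∑ i ∈ S, w i * l i ^ k) m *ᵥ v) =
        ∑ i ∈ S, w i * (p.eval (l i)) ^ 2 := by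
      simp only [star_trivial, dotProduct, mulVec, mat, of_apply, hpe, sq, Finset.mul_sum,
        Finset.sum_mul]
      rw [Finset.sum_comm (s := S)]
      refine Finset.sum_congr rfl fun a _ => ?_
      rw [Finset.sum_comm (s := S)]
      refine Finset.sum_congr rfl fun b _ => Finset.sum_congr rfl fun i _ => ?_
      rw [pow_add]
      ring
    rw [key]
    have hp0 : p ≠ 0 := by
      intro h0
      apply hv
      funext a
      have := congrArg (fun q => q.coeff a) h0
      simpa [hp, finsetSum_coeff, coeff_C_mul, coeff_X_pow, Fin.val_inj] using this
    have hdeg : p.degree < m := by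
      refine lt_of_le_of_lt (degree_sum_le _ _) ?_
      rw [Finset.sup_lt_iff (by exact_mod_cast WithBot.bot_lt_coe m)]
      intro a _
      exact lt_of_le_of_lt (degree_C_mul_X_pow_le _ _) (by exact_mod_cast a.2)
    have hex : ∃ i ∈ S, p.eval (l i) ≠ 0 := by
      by_contra! hcon
      refine hp0 (Polynomial.eq_zero_of_degree_lt_of_eval_finset_eq_zero (S.image l) ?_ ?_)
      · rw [Finset.card_image_of_injOn hl]
        exact lt_of_lt_of_le hdeg (by exact_mod_cast hm)
      · simpa using hcon
    obtain ⟨i, hi, hi0⟩ := hex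
    refine Finset.sum_pos' (fun j hj => mul_nonneg (hw j hj).le (sq_nonneg _))
      ⟨i, hi, mul_pos (hw i hi) (by positivity)⟩

end Hankel

/-! ### Krein strings: transfer recursions, Wronskian, degrees and energy. -/

/-- A finite Krein string on `(0, ∞)`: positions `0 < ξ 0 < ⋯ < ξ (N - 1)` carrying masses `ω n` and
dipoles `υ n`. -/
structure KreinString where
  N : ℕ
  ξ : ℕ → ℝ
  ω : ℕ → ℝ
  υ : ℕ → ℝ
  ξ_pos : ∀ n < N, 0 < ξ n
  ξ_lt : ∀ m n, m < n → n < N → ξ m < ξ n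
  υ_nonneg : ∀ n < N, 0 ≤ υ n
  ω_ne : ∀ n < N, υ n = 0 → ω n ≠ 0

namespace KreinString

open Polynomial

variable (S : KreinString)

/-- The weight `z ωₙ + z² υₙ` as a polynomial. -/
def weight (n : ℕ) : ℝ[X] := C (S.ω n) * X + C (S.υ n) * X ^ 2

/-- The coefficients of the solution which equals `1` near `∞`, after `j` points have been passed
from the right. -/
def rightAux : ℕ → ℝ[X] × ℝ[X]
  | 0 => (1, 0)
  | j + 1 =>
    ((rightAux j).1 - S.weight (S.N - (j + 1)) *
        ((rightAux j).1 + C (S.ξ (S.N - (j + 1))) * (rightAux j).2),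
      (rightAux j).2 + C (S.ξ (S.N - (j + 1)))⁻¹ * (S.weight (S.N - (j + 1)) *
        ((rightAux j).1 + C (S.ξ (S.N - (j + 1))) * (rightAux j).2)))

/-- Constant term of the right solution `ra n + rb n * ξ` to the left of the `n`-th point. -/
def ra (n : ℕ) : ℝ[X] := (S.rightAux (S.N - n)).1

/-- Slope of the right solution to the left of the `n`-th point. -/
def rb (n : ℕ) : ℝ[X] := (S.rightAux (S.N - n)).2

/-- Value of the right solution at the `n`-th point. -/
def rnode (n : ℕ) : ℝ[X] := S.ra (n + 1) + C (S.ξ n) * S.rb (n + 1)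

/-- The slope and the constant term of the solution `lb n + la n * ξ` which equals `ξ` near `0`. -/
def leftAux : ℕ → ℝ[X] × ℝ[X]
  | 0 => (1, 0)
  | n + 1 =>
    ((leftAux n).1 - C (S.ξ n)⁻¹ * (S.weight n * ((leftAux n).2 + C (S.ξ n) * (leftAux n).1)),
      (leftAux n).2 + S.weight n * ((leftAux n).2 + C (S.ξ n) * (leftAux n).1))

/-- Slope of the left solution to the left of the `n`-th point. -/
def la (n : ℕ) : ℝ[X] := (S.leftAux n).1

/-- Constant term of the left solution to the left of the `n`-th point. -/
def lb (n : ℕ) : ℝ[X] := (S.leftAux n).2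

/-- Value of the left solution at the `n`-th point. -/
def lnode (n : ℕ) : ℝ[X] := S.lb n + C (S.ξ n) * S.la n

/-- The polynomial whose roots are the eigenvalues. -/
def charPoly : ℝ[X] := S.ra 0

variable {S}

theorem ra_N : S.ra S.N = 1 := by simp [ra, rightAux]

theorem rb_N : S.rb S.N = 0 := by simp [rb, rightAux]

theorem ra_of_lt {n : ℕ} (h : n < S.N) : S.ra n = S.ra (n + 1) - S.weight n * S.rnode n := by
  obtain ⟨j, hj⟩ : ∃ j, S.N - n = j + 1 := ⟨S.N - n - 1, by omega⟩
  have h1 : S.N - (n + 1) = j := by omega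
  have h2 : S.N - (j + 1) = n := by omega
  simp only [ra, rnode, rb, hj, h1, rightAux, h2]

theorem rb_of_lt {n : ℕ} (h : n < S.N) :
    S.rb n = S.rb (n + 1) + C (S.ξ n)⁻¹ * (S.weight n * S.rnode n) := by
  obtain ⟨j, hj⟩ : ∃ j, S.N - n = j + 1 := ⟨S.N - n - 1, by omega⟩
  have h1 : S.N - (n + 1) = j := by omega
  have h2 : S.N - (j + 1) = n := by omega
  simp only [ra, rnode, rb, hj, h1, rightAux, h2]

theorem la_zero : S.la 0 = 1 := rfl

theorem lb_zero : S.lb 0 = 0 := rfl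

theorem la_succ (n : ℕ) : S.la (n + 1) = S.la n - C (S.ξ n)⁻¹ * (S.weight n * S.lnode n) := rfl

theorem lb_succ (n : ℕ) : S.lb (n + 1) = S.lb n + S.weight n * S.lnode n := rfl

theorem C_ξ_mul_inv {n : ℕ} (h : n < S.N) : C (S.ξ n) * C (S.ξ n)⁻¹ = 1 := by
  rw [← C_mul, mul_inv_cancel₀ (S.ξ_pos n h).ne', C_1]

theorem rnode_eq {n : ℕ} (h : n < S.N) : S.rnode n = S.ra n + C (S.ξ n) * S.rb n := by
  rw [ra_of_lt h, rb_of_lt h]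
  nth_rewrite 1 [rnode]
  linear_combination -(S.weight n * S.rnode n) * C_ξ_mul_inv h

theorem lnode_eq {n : ℕ} (h : n < S.N) :
    S.lnode n = S.lb (n + 1) + C (S.ξ n) * S.la (n + 1) := by
  rw [la_succ, lb_succ]
  nth_rewrite 1 [lnode]
  linear_combination (S.weight n * S.lnode n) * C_ξ_mul_inv h

theorem right_induction {motive : ℕ → Prop} (last : motive S.N)
    (step : ∀ n < S.N, motive (n + 1) → motive n) {n : ℕ} (h : n ≤ S.N) : motive n :=
  Nat.decreasingInduction (motive := fun k _ => motive k) (fun k hk => step k hk) last h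

theorem wronskian {n : ℕ} (h : n ≤ S.N) : S.la n * S.ra n - S.lb n * S.rb n = S.charPoly := by
  induction n with
  | zero => simp [la_zero, lb_zero, charPoly]
  | succ n ih =>
    have hn : n < S.N := h
    rw [← ih hn.le, la_succ, lb_succ, ra_of_lt hn, rb_of_lt hn]
    have h1 : S.rnode n = S.ra (n + 1) + C (S.ξ n) * S.rb (n + 1) := rfl
    have h2 : S.lnode n = S.lb n + C (S.ξ n) * S.la n := rfl
    linear_combination (-S.weight n * S.rnode n * C (S.ξ n)⁻¹) * h2 +
      S.weight n * S.lnode n * C (S.ξ n)⁻¹ * h1 +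
      (S.weight n * S.lnode n * S.rb (n + 1) - S.weight n * S.rnode n * S.la n) * C_ξ_mul_inv hn

theorem la_N : S.la S.N = S.charPoly := by
  have := wronskian (S := S) le_rfl
  rwa [ra_N, rb_N, mul_one, mul_zero, sub_zero] at this

theorem node_wronskian {n : ℕ} (h : n < S.N) :
    S.la (n + 1) * S.rnode n - S.lnode n * S.rb (n + 1) = S.charPoly := by
  rw [← wronskian (S := S) (n := n + 1) h, lnode_eq h, rnode]
  ring

theorem eval_zero_right {n : ℕ} (h : n ≤ S.N) : (S.ra n).eval 0 = 1 ∧ (S.rb n).eval 0 = 0 := by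
  refine right_induction (motive := fun n => (S.ra n).eval 0 = 1 ∧ (S.rb n).eval 0 = 0)
    ?_ ?_ h
  · simp [ra_N, rb_N]
  · intro n hn ih
    rw [ra_of_lt hn, rb_of_lt hn]
    simp [ih, weight]

theorem eval_zero_rnode {n : ℕ} (h : n < S.N) : (S.rnode n).eval 0 = 1 := by
  have := eval_zero_right (S := S) (n := n + 1) h
  simp [rnode, this]

theorem eval_zero_charPoly : S.charPoly.eval 0 = 1 := (eval_zero_right (Nat.zero_le _)).1

theorem eval_zero_left (n : ℕ) : (S.la n).eval 0 = 1 ∧ (S.lb n).eval 0 = 0 := by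
  induction n with
  | zero => simp [la_zero, lb_zero]
  | succ n ih =>
    rw [la_succ, lb_succ]
    simp [ih, weight]

theorem eval_zero_lnode (n : ℕ) : (S.lnode n).eval 0 = S.ξ n := by
  simp [lnode, eval_zero_left]

section Root

variable {R : Type*} [CommRing R] [Algebra ℝ R] {z : R}

/-- At an eigenvalue the left solution is a multiple of the right solution. -/
theorem aeval_left_of_root (hz : aeval z S.charPoly = 0) {n : ℕ} (h : n ≤ S.N) :
    aeval z (S.la n) = aeval z (S.lb S.N) * aeval z (S.rb n) ∧
      aeval z (S.lb n) = aeval z (S.lb S.N) * aeval z (S.ra n) := by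
  refine right_induction (motive := fun n =>
    aeval z (S.la n) = aeval z (S.lb S.N) * aeval z (S.rb n) ∧
      aeval z (S.lb n) = aeval z (S.lb S.N) * aeval z (S.ra n)) ?_ ?_ h
  -- To the right of all points the left solution has slope χ(z) = 0, so it is the constant `lb N`
  -- times the right solution there.
  · simp [ra_N, rb_N, la_N, hz]
  · intro n hn ih
    have h1 : aeval z (S.lnode n) = aeval z (S.lb S.N) * aeval z (S.rnode n) := by
      rw [lnode_eq hn, rnode]
      simp only [map_add, map_mul, ih.1, ih.2]
      ring
    have h2 := congrArg (aeval z) (la_succ (S := S) n)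
    have h3 := congrArg (aeval z) (lb_succ (S := S) n)
    rw [ra_of_lt hn, rb_of_lt hn]
    simp only [map_add, map_sub, map_mul, ih.1, ih.2, h1] at h2 h3 ⊢
    constructor
    · linear_combination -h2
    · linear_combination -h3

theorem aeval_lnode_of_root (hz : aeval z S.charPoly = 0) {n : ℕ} (h : n < S.N) :
    aeval z (S.lnode n) = aeval z (S.lb S.N) * aeval z (S.rnode n) := by
  have ih := aeval_left_of_root hz (n := n + 1) h
  rw [lnode_eq h, rnode]
  simp only [map_add, map_mul, ih.1, ih.2]
  ring

theorem aeval_lb_mul_rb_of_root (hz : aeval z S.charPoly = 0) :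
    aeval z (S.lb S.N) * aeval z (S.rb 0) = 1 := by
  rw [← (aeval_left_of_root hz (Nat.zero_le _)).1, la_zero, map_one]

end Root

/-- At a zero of χ this expresses γ² through χ'. The contribution of one point is found by writing
both constant terms as `rnode n` minus `ξ n` times the slope: the bracket becomes F b' - F' b, and
the jump of b leaves only the derivative of the weight. -/
theorem derivative_identity :
    S.ra 0 * derivative (S.rb 0) - derivative (S.ra 0) * S.rb 0 =
      ∑ n ∈ Finset.range S.N, C (S.ξ n)⁻¹ * derivative (S.weight n) * S.rnode n ^ 2 := by
  have := right_induction (S := S) (n := 0) (motive := fun n =>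
    S.ra n * derivative (S.rb n) - derivative (S.ra n) * S.rb n =
      ∑ n ∈ Finset.Ico n S.N, C (S.ξ n)⁻¹ * derivative (S.weight n) * S.rnode n ^ 2) ?_ ?_
    (Nat.zero_le _)
  · rwa [Finset.range_eq_Ico]
  · simp [ra_N, rb_N]
  · intro n hn ih
    rw [Finset.sum_eq_sum_Ico_succ_bot hn, ← ih]
    have e1 := rnode_eq hn
    have e2 : S.rnode n = S.ra (n + 1) + C (S.ξ n) * S.rb (n + 1) := rfl
    have d1 := congrArg derivative e1
    have d2 := congrArg derivative e2
    have e3 := rb_of_lt hn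
    have d3 := congrArg derivative e3
    simp only [derivative_add, derivative_mul, derivative_C, zero_mul, zero_add] at d1 d2 d3
    have a1 : S.ra n = S.rnode n - C (S.ξ n) * S.rb n := by rw [e1]; ring
    have a2 : S.ra (n + 1) = S.rnode n - C (S.ξ n) * S.rb (n + 1) := by rw [e2]; ring
    have a3 : derivative (S.ra n) = derivative (S.rnode n) - C (S.ξ n) * derivative (S.rb n) := by
      rw [d1]; ring
    have a4 : derivative (S.ra (n + 1)) =
      derivative (S.rnode n) - C (S.ξ n) * derivative (S.rb (n + 1)) := by rw [d2]; ring
    rw [a3, a4, a1, a2, e3, derivative_add, derivative_mul, derivative_mul, derivative_C]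
    ring

/-- Number of powers of `z` carried by the `n`-th point. -/
def deg (S : KreinString) (n : ℕ) : ℕ := if S.υ n = 0 then 1 else 2

/-- Leading coefficient of the `n`-th weight. -/
def lead (S : KreinString) (n : ℕ) : ℝ := if S.υ n = 0 then S.ω n else S.υ n

/-- Degree of the right solution to the left of the `n`-th point. -/
def rdeg (S : KreinString) (n : ℕ) : ℕ := ∑ m ∈ Finset.Ico n S.N, S.deg m

/-- Degree of the left solution to the left of the `n`-th point. -/
def ldeg (S : KreinString) (n : ℕ) : ℕ := ∑ m ∈ Finset.range n, S.deg m

theorem one_le_deg (n : ℕ) : 1 ≤ S.deg n := by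
  unfold deg; split_ifs <;> norm_num

theorem rdeg_N : S.rdeg S.N = 0 := by simp [rdeg]

theorem rdeg_of_lt {n : ℕ} (h : n < S.N) : S.rdeg n = S.deg n + S.rdeg (n + 1) :=
  Finset.sum_eq_sum_Ico_succ_bot h _

theorem ldeg_succ (n : ℕ) : S.ldeg (n + 1) = S.deg n + S.ldeg n := by
  rw [ldeg, Finset.sum_range_succ, add_comm, ldeg]

theorem ldeg_add_rdeg {n : ℕ} (h : n ≤ S.N) : S.ldeg n + S.rdeg n = S.rdeg 0 := by
  rw [ldeg, rdeg, rdeg, Finset.range_eq_Ico]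
  exact Finset.sum_Ico_consecutive _ (Nat.zero_le _) h

theorem lead_ne {n : ℕ} (h : n < S.N) : S.lead n ≠ 0 := by
  unfold lead
  split_ifs with h0
  exacts [S.ω_ne n h h0, h0]

theorem natDegree_weight_le (n : ℕ) : (S.weight n).natDegree ≤ S.deg n := by
  unfold weight deg
  split_ifs with h0
  · rw [h0, C_0, zero_mul, add_zero]; compute_degree
  · compute_degree

theorem coeff_weight (n : ℕ) : (S.weight n).coeff (S.deg n) = S.lead n := by
  unfold weight deg lead
  split_ifs with h0
  · simp [h0]
  · simp

/-- The nonvanishing is proved for every `t` to the left of the n-th point because the induction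
needs it at the previous point: passing a point multiplies the leading coefficient by its leading
weight and by t/ξₙ - 1. -/
theorem right_degree {n : ℕ} (h : n ≤ S.N) :
    (S.ra n).natDegree ≤ S.rdeg n ∧ (S.rb n).natDegree ≤ S.rdeg n ∧
      ∀ t : ℝ, (n < S.N → t < S.ξ n) → (S.ra n + C t * S.rb n).coeff (S.rdeg n) ≠ 0 := by
  refine right_induction (motive := fun n =>
    (S.ra n).natDegree ≤ S.rdeg n ∧ (S.rb n).natDegree ≤ S.rdeg n ∧
      ∀ t : ℝ, (n < S.N → t < S.ξ n) → (S.ra n + C t * S.rb n).coeff (S.rdeg n) ≠ 0) ?_ ?_ h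
  · simp [ra_N, rb_N, rdeg_N]
  · rintro n hn ⟨h1, h2, h3⟩
    have hF : (S.rnode n).natDegree ≤ S.rdeg (n + 1) :=
      natDegree_add_le_of_degree_le h1 ((natDegree_C_mul_le _ _).trans h2)
    have hF0 : (S.rnode n).coeff (S.rdeg (n + 1)) ≠ 0 :=
      h3 _ fun h' => S.ξ_lt _ _ (Nat.lt_succ_self n) h'
    have hcF : (S.weight n * S.rnode n).natDegree ≤ S.rdeg n := by
      rw [rdeg_of_lt hn]
      exact natDegree_mul_le_of_le (natDegree_weight_le n) hF
    have hlt : S.rdeg (n + 1) < S.rdeg n := by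
      have := one_le_deg (S := S) n; rw [rdeg_of_lt hn]; omega
    have hcF0 : (S.weight n * S.rnode n).coeff (S.rdeg n) =
        S.lead n * (S.rnode n).coeff (S.rdeg (n + 1)) := by
      rw [rdeg_of_lt hn, coeff_mul_add_eq_of_natDegree_le (natDegree_weight_le n) hF, coeff_weight]
    refine ⟨?_, ?_, ?_⟩
    · rw [ra_of_lt hn]
      exact (natDegree_sub_le_of_le (h1.trans hlt.le) hcF).trans (max_self _).le
    · rw [rb_of_lt hn]
      exact natDegree_add_le_of_degree_le (h2.trans hlt.le) ((natDegree_C_mul_le _ _).trans hcF)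
    · intro t ht
      rw [ra_of_lt hn, rb_of_lt hn]
      simp only [coeff_add, coeff_sub, coeff_C_mul, hcF0,
        coeff_eq_zero_of_natDegree_lt (h1.trans_lt hlt),
        coeff_eq_zero_of_natDegree_lt (h2.trans_lt hlt)]
      have hξ := S.ξ_pos n hn
      have ht' := ht hn
      have : 0 - S.lead n * (S.rnode n).coeff (S.rdeg (n + 1)) + t * (0 + (S.ξ n)⁻¹ *
          (S.lead n * (S.rnode n).coeff (S.rdeg (n + 1)))) =
          (t / S.ξ n - 1) * (S.lead n * (S.rnode n).coeff (S.rdeg (n + 1))) := by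
        field_simp
        ring
      rw [this]
      refine mul_ne_zero (sub_ne_zero.2 ?_) (mul_ne_zero (lead_ne hn) hF0)
      rw [Ne, div_eq_one_iff_eq hξ.ne']
      exact ht'.ne

theorem natDegree_rnode_le {n : ℕ} (h : n < S.N) : (S.rnode n).natDegree ≤ S.rdeg (n + 1) :=
  natDegree_add_le_of_degree_le (right_degree (n := n + 1) h).1
    ((natDegree_C_mul_le _ _).trans (right_degree (n := n + 1) h).2.1)

theorem natDegree_charPoly : S.charPoly.natDegree = S.rdeg 0 := by
  have := right_degree (S := S) (Nat.zero_le _)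
  refine natDegree_eq_of_le_of_coeff_ne_zero this.1 ?_
  have h0 := this.2.2 0 fun h => S.ξ_pos 0 h
  simpa [charPoly] using h0

theorem left_degree {n : ℕ} (h : n ≤ S.N) :
    (S.la n).natDegree ≤ S.ldeg n ∧ (S.lb n).natDegree ≤ S.ldeg n ∧
      ∀ t : ℝ, 0 < t → (∀ m < n, S.ξ m < t) → (S.lb n + C t * S.la n).coeff (S.ldeg n) ≠ 0 := by
  induction n with
  | zero =>
    simp only [la_zero, lb_zero, ldeg]
    refine ⟨by simp, by simp, fun t ht _ => by simpa using ht.ne'⟩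
  | succ n ih =>
    have hn : n < S.N := h
    obtain ⟨h1, h2, h3⟩ := ih hn.le
    have hF : (S.lnode n).natDegree ≤ S.ldeg n :=
      natDegree_add_le_of_degree_le h2 ((natDegree_C_mul_le _ _).trans h1)
    have hF0 : (S.lnode n).coeff (S.ldeg n) ≠ 0 :=
      h3 _ (S.ξ_pos n hn) fun m hm => S.ξ_lt m n hm hn
    have hcF : (S.weight n * S.lnode n).natDegree ≤ S.ldeg (n + 1) := by
      rw [ldeg_succ]
      exact natDegree_mul_le_of_le (natDegree_weight_le n) hF
    have hlt : S.ldeg n < S.ldeg (n + 1) := by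
      have := one_le_deg (S := S) n; rw [ldeg_succ]; omega
    have hcF0 : (S.weight n * S.lnode n).coeff (S.ldeg (n + 1)) =
        S.lead n * (S.lnode n).coeff (S.ldeg n) := by
      rw [ldeg_succ, coeff_mul_add_eq_of_natDegree_le (natDegree_weight_le n) hF, coeff_weight]
    refine ⟨?_, ?_, ?_⟩
    · rw [la_succ]
      exact (natDegree_sub_le_of_le (h1.trans hlt.le)
        ((natDegree_C_mul_le _ _).trans hcF)).trans (max_self _).le
    · rw [lb_succ]
      exact natDegree_add_le_of_degree_le (h2.trans hlt.le) hcF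
    · intro t _ ht
      rw [la_succ, lb_succ]
      simp only [coeff_add, coeff_sub, coeff_C_mul, hcF0,
        coeff_eq_zero_of_natDegree_lt (h1.trans_lt hlt),
        coeff_eq_zero_of_natDegree_lt (h2.trans_lt hlt)]
      have hξ := S.ξ_pos n hn
      have ht' := ht n (Nat.lt_succ_self n)
      have : 0 + S.lead n * (S.lnode n).coeff (S.ldeg n) + t * (0 - (S.ξ n)⁻¹ *
          (S.lead n * (S.lnode n).coeff (S.ldeg n))) =
          (1 - t / S.ξ n) * (S.lead n * (S.lnode n).coeff (S.ldeg n)) := by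
        field_simp
        ring
      rw [this]
      refine mul_ne_zero (sub_ne_zero.2 ?_) (mul_ne_zero (lead_ne hn) hF0)
      rw [Ne, eq_comm, div_eq_one_iff_eq hξ.ne']
      exact ht'.ne'

theorem natDegree_lnode_le {n : ℕ} (h : n < S.N) : (S.lnode n).natDegree ≤ S.ldeg n :=
  natDegree_add_le_of_degree_le (left_degree h.le).2.1
    ((natDegree_C_mul_le _ _).trans (left_degree h.le).1)

/-- Compares top coefficients in `node_wronskian`; the product `lnode n * rb (n + 1)` has too low a
degree to contribute. -/
theorem coeff_charPoly_eq {n : ℕ} (h : n < S.N) :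
    S.ξ n * S.charPoly.coeff (S.rdeg 0) =
      -(S.lead n * (S.lnode n).coeff (S.ldeg n) * (S.rnode n).coeff (S.rdeg (n + 1))) := by
  have hd := one_le_deg (S := S) n
  have hs := ldeg_succ (S := S) n
  rw [← node_wronskian h, ← ldeg_add_rdeg (n := n + 1) h, coeff_sub,
    coeff_mul_add_eq_of_natDegree_le (left_degree (n := n + 1) h).1 (natDegree_rnode_le h),
    coeff_eq_zero_of_natDegree_lt (p := S.lnode n * S.rb (n + 1)), la_succ, coeff_sub,
    coeff_eq_zero_of_natDegree_lt (p := S.la n), coeff_C_mul, ldeg_succ,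
    coeff_mul_add_eq_of_natDegree_le (natDegree_weight_le n) (natDegree_lnode_le h), coeff_weight]
  · have := (S.ξ_pos n h).ne'
    field_simp
    ring
  · have := (left_degree (S := S) h.le).1
    omega
  · have := natDegree_mul_le_of_le (natDegree_lnode_le h) (right_degree (S := S) (n := n + 1) h).2.1
    omega

/-- Summation by parts for the right solution at an eigenvalue. -/
theorem exists_energy {z : ℂ} (hz : aeval z S.charPoly = 0) :
    ∃ r : ℝ, 0 < r ∧ ∑ n ∈ Finset.range S.N, aeval z (S.weight n) *
      ((‖aeval z (S.rnode n)‖ ^ 2 / S.ξ n : ℝ) : ℂ) = r := by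
  -- `r` is the Dirichlet energy, the integral of |F'|² over (0, ∞), with the slope left of the n-th
  -- point continued down to 0. The product of `rb` and the conjugate of `ra` is the boundary term,
  -- which vanishes at an eigenvalue for n = 0.
  have key := right_induction (S := S) (n := 0) (motive := fun n => ∃ r : ℝ,
    (n < S.N → S.ξ n * ‖aeval z (S.rb n)‖ ^ 2 ≤ r) ∧ (S.N ≤ n → 0 ≤ r) ∧
    ∑ n ∈ Finset.Ico n S.N, aeval z (S.weight n) *
      ((‖aeval z (S.rnode n)‖ ^ 2 / S.ξ n : ℝ) : ℂ) =
        aeval z (S.rb n) * starRingEnd ℂ (aeval z (S.ra n)) + r) ?_ ?_ (Nat.zero_le _)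
  · obtain ⟨r, h1, -, h3⟩ := key
    have hN : 0 < S.N := by
      by_contra! hN
      have h0 : S.N = 0 := by omega
      have : S.ra 0 = 1 := by rw [← ra_N, h0]
      simp [charPoly, this] at hz
    refine ⟨r, lt_of_lt_of_le ?_ (h1 hN), ?_⟩
    · have hb : aeval z (S.rb 0) ≠ 0 := right_ne_zero_of_mul_eq_one (aeval_lb_mul_rb_of_root hz)
      have := S.ξ_pos 0 hN
      positivity
    · rw [Finset.range_eq_Ico, h3]
      have : aeval z (S.ra 0) = 0 := hz
      simp [this]
  · exact ⟨0, by simp, by simp, by simp [rb_N]⟩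
  · rintro n hn ⟨r, h1, h2, h3⟩
    have hξ := S.ξ_pos n hn
    refine ⟨r - S.ξ n * ‖aeval z (S.rb (n + 1))‖ ^ 2 + S.ξ n * ‖aeval z (S.rb n)‖ ^ 2, ?_, ?_, ?_⟩
    · intro _
      have : S.ξ n * ‖aeval z (S.rb (n + 1))‖ ^ 2 ≤ r := by
        rcases Nat.lt_or_ge (n + 1) S.N with h | h
        · refine le_trans ?_ (h1 h)
          have := S.ξ_lt n (n + 1) (Nat.lt_succ_self n) h
          gcongr
        · have hN : n + 1 = S.N := by omega
          rw [hN, rb_N]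
          simpa using h2 h
      linarith
    · omega
    · rw [Finset.sum_eq_sum_Ico_succ_bot hn, h3]
      have hc : (S.ξ n : ℂ) ≠ 0 := by exact_mod_cast hξ.ne'
      have e1 := congrArg (aeval z) (rnode_eq hn)
      have e2 := congrArg (aeval z) (show S.rnode n = S.ra (n + 1) + C (S.ξ n) * S.rb (n + 1)
        from rfl)
      have e3 := congrArg (aeval z) (rb_of_lt hn)
      simp only [map_add, map_mul, aeval_C, Complex.coe_algebraMap, Complex.ofReal_inv] at e1 e2 e3
      have e1' := congrArg (starRingEnd ℂ) e1
      have e2' := congrArg (starRingEnd ℂ) e2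
      simp only [map_add, map_mul, Complex.conj_ofReal] at e1' e2'
      push_cast
      rw [← Complex.mul_conj', ← Complex.mul_conj', ← Complex.mul_conj', div_eq_mul_inv]
      linear_combination (-starRingEnd ℂ (aeval z (S.rnode n))) * e3 +
        aeval z (S.rb n) * e1' - aeval z (S.rb (n + 1)) * e2'

end KreinString

/-! ### From the differential equation to the string. -/

namespace PeakonString

namespace DiscretePair

open Polynomial

variable (P : DiscretePair)

/-- The Krein string obtained from the substitution `ξ = exp x`. -/
def toKreinString : KreinString where
  N := P.N
  ξ n := if h : n < P.N then Real.exp (P.x ⟨n, h⟩) else 0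
  ω n := if h : n < P.N then P.ω ⟨n, h⟩ else 0
  υ n := if h : n < P.N then P.υ ⟨n, h⟩ else 0
  ξ_pos n h := by simp only [h, dif_pos]; exact Real.exp_pos _
  ξ_lt m n hmn h := by
    simp only [h, hmn.trans h, dif_pos]
    exact Real.exp_lt_exp.2 (P.strictMono_x hmn)
  υ_nonneg n h := by simp only [h, dif_pos]; exact P.υ_nonneg _
  ω_ne n h := by
    simp only [h, dif_pos]
    intro h0 h1
    have := P.weight_pos ⟨n, h⟩
    simp [h0, h1] at this

theorem toKreinString_ξ (m : Fin P.N) : P.toKreinString.ξ m = Real.exp (P.x m) := by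
  simp [toKreinString]

theorem toKreinString_ω (m : Fin P.N) : P.toKreinString.ω m = P.ω m := by
  simp [toKreinString]

theorem toKreinString_υ (m : Fin P.N) : P.toKreinString.υ m = P.υ m := by
  simp [toKreinString]

/-- The interval between the points with indices `n - 1` and `n`. -/
def gap (n : ℕ) : Set ℝ :=
  {t | (∀ m : Fin P.N, (m : ℕ) < n → P.x m < t) ∧ ∀ m : Fin P.N, n ≤ m → t < P.x m}

variable {P}

theorem isOpen_gap (n : ℕ) : IsOpen (P.gap n) := by
  have : P.gap n = (⋂ m : Fin P.N, ⋂ _ : (m : ℕ) < n, Set.Ioi (P.x m)) ∩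
      ⋂ m : Fin P.N, ⋂ _ : n ≤ m, Set.Iio (P.x m) := by
    ext t; simp [gap]
  rw [this]
  exact (isOpen_iInter_of_finite fun _ => isOpen_iInter_of_finite fun _ => isOpen_Ioi).inter
    (isOpen_iInter_of_finite fun _ => isOpen_iInter_of_finite fun _ => isOpen_Iio)

theorem ordConnected_gap (n : ℕ) : (P.gap n).OrdConnected :=
  ⟨fun _ hs _ ht _ hr => ⟨fun m hm => (hs.1 m hm).trans_le hr.1,
    fun m hm => hr.2.trans_lt (ht.2 m hm)⟩⟩

theorem notMem_range_of_mem_gap {n : ℕ} {t : ℝ} (ht : t ∈ P.gap n) : t ∉ Set.range P.x := by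
  rintro ⟨m, rfl⟩
  rcases Nat.lt_or_ge (m : ℕ) n with h | h
  · exact lt_irrefl _ (ht.1 m h)
  · exact lt_irrefl _ (ht.2 m h)

theorem gap_mem_nhdsLT (n : Fin P.N) : P.gap n ∈ 𝓝[<] (P.x n) := by
  have h1 : ∀ᶠ t in 𝓝[<] (P.x n), ∀ m : Fin P.N, (m : ℕ) < n → P.x m < t := by
    rw [eventually_all]
    intro m
    by_cases h : (m : ℕ) < n
    · filter_upwards [Ioo_mem_nhdsLT (P.strictMono_x h)] with t ht _ using ht.1
    · exact Eventually.of_forall fun t h' => absurd h' h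
  filter_upwards [h1, self_mem_nhdsWithin] with t ht ht'
  exact ⟨ht, fun m hm => lt_of_lt_of_le ht' (P.strictMono_x.monotone hm)⟩

theorem gap_mem_nhdsGT (n : Fin P.N) : P.gap (n + 1) ∈ 𝓝[>] (P.x n) := by
  have h1 : ∀ᶠ t in 𝓝[>] (P.x n), ∀ m : Fin P.N, (n : ℕ) + 1 ≤ m → t < P.x m := by
    rw [eventually_all]
    intro m
    by_cases h : (n : ℕ) + 1 ≤ m
    · filter_upwards [Ioo_mem_nhdsGT (P.strictMono_x (show n < m from h))] with t ht _ using ht.2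
    · exact Eventually.of_forall fun t h' => absurd h' h
  filter_upwards [h1, self_mem_nhdsWithin] with t ht ht'
  exact ⟨fun m hm => lt_of_le_of_lt (P.strictMono_x.monotone (Nat.lt_succ_iff.1 hm)) ht', ht⟩

theorem gap_mem_atTop : P.gap P.N ∈ (atTop : Filter ℝ) := by
  have : ∀ᶠ t : ℝ in atTop, ∀ m, P.x m < t := by
    rw [eventually_all]
    exact fun m => eventually_gt_atTop (P.x m)
  filter_upwards [this] with t ht using ⟨fun m _ => ht m, fun m hm => absurd m.2 (by omega)⟩

theorem gap_mem_atBot : P.gap 0 ∈ (atBot : Filter ℝ) := by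
  have : ∀ᶠ t : ℝ in atBot, ∀ m, t < P.x m := by
    rw [eventually_all]
    exact fun m => eventually_lt_atBot (P.x m)
  filter_upwards [this] with t ht using ⟨fun m hm => absurd hm (by omega), fun m _ => ht m⟩

theorem exists_mem_gap {t : ℝ} (ht : ∀ m, P.x m ≠ t) : ∃ n ≤ P.N, t ∈ P.gap n := by
  classical
  have hex : ∃ n : ℕ, ∀ m : Fin P.N, n ≤ m → t < P.x m := ⟨P.N, fun m hm => absurd m.2 (by omega)⟩
  refine ⟨Nat.find hex, Nat.find_min' hex fun m hm => absurd m.2 (by omega), fun m hm => ?_,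
    Nat.find_spec hex⟩
  have := Nat.find_min hex hm
  push Not at this
  obtain ⟨k, hk, hkt⟩ := this
  exact lt_of_le_of_ne ((P.strictMono_x.monotone hk).trans hkt) (ht m)

/-- The function `α exp (-t / 2) + β exp (t / 2)`. -/
def expComb (α β : ℂ) (t : ℝ) : ℂ :=
  α * Complex.exp (-(t : ℂ) / 2) + β * Complex.exp ((t : ℂ) / 2)

theorem continuous_expComb (α β : ℂ) : Continuous (expComb α β) := by
  unfold expComb
  fun_prop

theorem hasDerivAt_exp_half (t : ℝ) :
    HasDerivAt (fun t : ℝ => Complex.exp ((t : ℂ) / 2)) (Complex.exp ((t : ℂ) / 2) / 2) t := by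
  have := ((hasDerivAt_id (t : ℂ)).div_const 2).cexp.comp_ofReal
  refine this.congr_deriv ?_
  simp
  ring

theorem hasDerivAt_exp_neg_half (t : ℝ) :
    HasDerivAt (fun t : ℝ => Complex.exp (-(t : ℂ) / 2)) (-Complex.exp (-(t : ℂ) / 2) / 2) t := by
  have := ((hasDerivAt_id (t : ℂ)).neg.div_const 2).cexp.comp_ofReal
  refine this.congr_deriv ?_
  simp
  ring

theorem exp_half_mul (t : ℝ) : Complex.exp ((t : ℂ) / 2) * Complex.exp (-(t : ℂ) / 2) = 1 := by
  rw [← Complex.exp_add]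
  simp [neg_div]

variable {z : ℂ} {f : ℝ → ℂ}

theorem IsSolution.exists_expComb (hf : P.IsSolution z f) (n : ℕ) : ∃ α β : ℂ, ∀ t ∈ P.gap n,
    f t = expComb α β t ∧ deriv f t = expComb (-α / 2) (β / 2) t := by
  rcases (P.gap n).eq_empty_or_nonempty with he | ⟨s, hs⟩
  · exact ⟨0, 0, by simp [he]⟩
  -- The coefficients of exp(-t/2) and exp(t/2) recovered from f and f'; by the equation both are
  -- constant on a gap.
  set g : ℝ → ℂ := fun t => (f t - 2 * deriv f t) * Complex.exp ((t : ℂ) / 2) / 2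
  set h : ℝ → ℂ := fun t => (f t + 2 * deriv f t) * Complex.exp (-(t : ℂ) / 2) / 2
  have hg : ∀ t ∈ P.gap n, HasDerivAt g 0 t := by
    intro t ht
    have h1 := (hf.differentiableAt t (notMem_range_of_mem_gap ht)).hasDerivAt
    have h2 := hf.ode t (notMem_range_of_mem_gap ht)
    refine (((h1.sub (h2.const_mul 2)).mul (hasDerivAt_exp_half t)).div_const 2).congr_deriv ?_
    simp only [Pi.sub_apply]
    ring
  have hh : ∀ t ∈ P.gap n, HasDerivAt h 0 t := by
    intro t ht
    have h1 := (hf.differentiableAt t (notMem_range_of_mem_gap ht)).hasDerivAt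
    have h2 := hf.ode t (notMem_range_of_mem_gap ht)
    refine (((h1.add (h2.const_mul 2)).mul (hasDerivAt_exp_neg_half t)).div_const 2).congr_deriv ?_
    simp only [Pi.add_apply]
    ring
  have hc : ∀ g : ℝ → ℂ, (∀ t ∈ P.gap n, HasDerivAt g 0 t) → ∀ t ∈ P.gap n, g t = g s :=
    fun g hg t ht => (isOpen_gap n).is_const_of_deriv_eq_zero (ordConnected_gap n).isPreconnected
      (fun t ht => (hg t ht).differentiableAt.differentiableWithinAt)
      (fun t ht => (hg t ht).deriv) ht hs
  refine ⟨g s, h s, fun t ht => ?_⟩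
  rw [← hc g hg t ht, ← hc h hh t ht]
  have he := exp_half_mul t
  simp only [expComb, g, h]
  constructor
  · linear_combination (-f t) * he
  · linear_combination (-deriv f t) * he

/-- The coefficients of a solution on the gaps obey the recursion of a Krein string. -/
theorem IsSolution.exists_coeffs (hf : P.IsSolution z f) : ∃ α β : ℕ → ℂ,
    (∀ n, ∀ t ∈ P.gap n, f t = expComb (α n) (β n) t) ∧ ∀ n : Fin P.N,
      f (P.x n) = expComb (α (n + 1)) (β (n + 1)) (P.x n) ∧
      α n = α (n + 1) - aeval z (P.toKreinString.weight n) *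
        (α (n + 1) + P.toKreinString.ξ n * β (n + 1)) ∧
      β n = β (n + 1) + (P.toKreinString.ξ n : ℂ)⁻¹ * (aeval z (P.toKreinString.weight n) *
        (α (n + 1) + P.toKreinString.ξ n * β (n + 1))) := by
  choose α β h using hf.exists_expComb
  refine ⟨α, β, fun n t ht => (h n t ht).1, fun n => ?_⟩
  have hfl : f (P.x n) = expComb (α n) (β n) (P.x n) := by
    refine tendsto_nhds_unique (hf.continuous.continuousAt.tendsto.mono_left
      (nhdsWithin_le_nhds (s := Set.Iio (P.x n)))) ?_
    refine ((continuous_expComb (α n) (β n)).continuousAt.tendsto.mono_left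
      nhdsWithin_le_nhds).congr' ?_
    filter_upwards [gap_mem_nhdsLT n] with t ht using (h n t ht).1.symm
  have hfr : f (P.x n) = expComb (α (n + 1)) (β (n + 1)) (P.x n) := by
    refine tendsto_nhds_unique (hf.continuous.continuousAt.tendsto.mono_left
      (nhdsWithin_le_nhds (s := Set.Ioi (P.x n)))) ?_
    refine ((continuous_expComb _ _).continuousAt.tendsto.mono_left nhdsWithin_le_nhds).congr' ?_
    filter_upwards [gap_mem_nhdsGT n] with t ht using (h (n + 1) t ht).1.symm
  obtain ⟨a, b, ha, hb, hab⟩ := hf.jump n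
  have hal : a = expComb (-α n / 2) (β n / 2) (P.x n) := by
    refine tendsto_nhds_unique ha ?_
    refine ((continuous_expComb _ _).continuousAt.tendsto.mono_left nhdsWithin_le_nhds).congr' ?_
    filter_upwards [gap_mem_nhdsLT n] with t ht using (h n t ht).2.symm
  have hbr : b = expComb (-α (n + 1) / 2) (β (n + 1) / 2) (P.x n) := by
    refine tendsto_nhds_unique hb ?_
    refine ((continuous_expComb _ _).continuousAt.tendsto.mono_left nhdsWithin_le_nhds).congr' ?_
    filter_upwards [gap_mem_nhdsGT n] with t ht using (h (n + 1) t ht).2.symm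
  have hw : aeval z (P.toKreinString.weight n) = z * (P.ω n : ℂ) + z ^ 2 * (P.υ n : ℂ) := by
    simp only [KreinString.weight, toKreinString_ω, toKreinString_υ, map_add, map_mul, map_pow,
      aeval_C, aeval_X, Complex.coe_algebraMap]
    ring
  have hE := exp_half_mul (P.x n)
  have hξ : (P.toKreinString.ξ n : ℂ) = Complex.exp ((P.x n : ℂ) / 2) ^ 2 := by
    rw [toKreinString_ξ, ← Complex.exp_nat_mul, Complex.ofReal_exp]
    congr 1
    push_cast
    ring
  have hξ' : (P.toKreinString.ξ n : ℂ)⁻¹ = Complex.exp (-(P.x n : ℂ) / 2) ^ 2 := by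
    rw [hξ, ← inv_pow, neg_div, Complex.exp_neg]
  refine ⟨hfr, ?_⟩
  rw [hw, hξ', hξ]
  simp only [expComb] at hfl hfr hal hbr
  set E := Complex.exp ((P.x n : ℂ) / 2)
  set e := Complex.exp (-(P.x n : ℂ) / 2)
  set c := z * (P.ω n : ℂ) + z ^ 2 * (P.υ n : ℂ)
  have hF : f (P.x n) * E = α (n + 1) + E ^ 2 * β (n + 1) := by
    linear_combination E * hfr + α (n + 1) * hE
  have h1 : α n * e = α (n + 1) * e - c * f (P.x n) := by
    linear_combination (hfr - hfl) / 2 + hal - hbr - hab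
  have h2 : β n * E = β (n + 1) * E + c * f (P.x n) := by
    linear_combination (hfr - hfl) / 2 - hal + hbr + hab
  rw [← hF]
  constructor
  · linear_combination E * h1 + (-α n + α (n + 1)) * hE
  · linear_combination e * h2 + (-β n + β (n + 1) - c * f (P.x n) * e) * hE

theorem eq_zero_of_expComb_bounded {α β : ℂ} {C : ℝ} (h : ∀ᶠ t in atTop, ‖expComb α β t‖ ≤ C) :
    β = 0 := by
  by_contra hβ
  have h1 : Tendsto (fun t : ℝ => ‖β‖ * Real.exp (t / 2)) atTop atTop :=
    (Real.tendsto_exp_atTop.comp (tendsto_id.atTop_div_const two_pos)).const_mul_atTop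
      (norm_pos_iff.2 hβ)
  obtain ⟨t, h2, h3, h4⟩ := (h.and ((eventually_ge_atTop 0).and
    (h1.eventually_gt_atTop (C + ‖α‖)))).exists
  have h5 : ‖α * Complex.exp (-(t : ℂ) / 2)‖ ≤ ‖α‖ := by
    rw [norm_mul, Complex.norm_exp]
    refine mul_le_of_le_one_right (norm_nonneg _) (Real.exp_le_one_iff.2 ?_)
    simp only [Complex.div_ofNat_re, Complex.neg_re, Complex.ofReal_re]
    linarith
  have h6 : ‖β * Complex.exp ((t : ℂ) / 2)‖ = ‖β‖ * Real.exp (t / 2) := by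
    rw [norm_mul, Complex.norm_exp]
    simp
  have h7 := norm_sub_le (expComb α β t) (α * Complex.exp (-(t : ℂ) / 2))
  rw [expComb, add_sub_cancel_left, h6] at h7
  rw [expComb] at h2
  linarith

theorem eq_zero_of_expComb_bounded' {α β : ℂ} {C : ℝ} (h : ∀ᶠ t in atBot, ‖expComb α β t‖ ≤ C) :
    α = 0 := by
  refine eq_zero_of_expComb_bounded (α := β) (C := C) ?_
  filter_upwards [tendsto_neg_atTop_atBot.eventually h] with t ht
  simpa [expComb, add_comm] using ht

theorem coeffs_eq {α β : ℕ → ℂ} (h : ∀ n : Fin P.N,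
      α n = α (n + 1) - aeval z (P.toKreinString.weight n) *
        (α (n + 1) + P.toKreinString.ξ n * β (n + 1)) ∧
      β n = β (n + 1) + (P.toKreinString.ξ n : ℂ)⁻¹ * (aeval z (P.toKreinString.weight n) *
        (α (n + 1) + P.toKreinString.ξ n * β (n + 1)))) (h0 : β P.N = 0) {n : ℕ} (hn : n ≤ P.N) :
    α n = α P.N * aeval z (P.toKreinString.ra n) ∧
      β n = α P.N * aeval z (P.toKreinString.rb n) := by
  refine KreinString.right_induction (S := P.toKreinString) (motive := fun n =>
    α n = α P.N * aeval z (P.toKreinString.ra n) ∧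
      β n = α P.N * aeval z (P.toKreinString.rb n)) ?_ ?_ hn
  · rw [KreinString.ra_N, KreinString.rb_N]
    simp only [map_one, mul_one, map_zero, mul_zero]
    exact ⟨rfl, h0⟩
  · intro n hn ih
    obtain ⟨h1, h2⟩ := h ⟨n, hn⟩
    simp only at h1 h2
    rw [h1, h2, ih.1, ih.2, KreinString.ra_of_lt hn, KreinString.rb_of_lt hn, KreinString.rnode]
    simp only [map_add, map_sub, map_mul, aeval_C, Complex.coe_algebraMap, Complex.ofReal_inv]
    constructor <;> ring

theorem phiPlus_isSolution (P : DiscretePair) (z : ℂ) : P.IsSolution z (P.phiPlus z) :=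
  (P.exists_phiPlus z).choose_spec.1

theorem phiPlus_eventually (P : DiscretePair) (z : ℂ) :
    ∀ᶠ t : ℝ in atTop, P.phiPlus z t = Complex.exp (-(t : ℂ) / 2) :=
  (P.exists_phiPlus z).choose_spec.2

theorem phiPlus_coeffs (P : DiscretePair) (z : ℂ) :
    (∀ n ≤ P.N, ∀ t ∈ P.gap n, P.phiPlus z t = expComb (aeval z (P.toKreinString.ra n))
      (aeval z (P.toKreinString.rb n)) t) ∧ ∀ n : Fin P.N,
      P.phiPlus z (P.x n) = expComb (aeval z (P.toKreinString.ra (n + 1)))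
        (aeval z (P.toKreinString.rb (n + 1))) (P.x n) := by
  obtain ⟨α, β, h1, h2⟩ := (P.phiPlus_isSolution z).exists_coeffs
  have hev : ∀ᶠ t : ℝ in atTop, Complex.exp (-(t : ℂ) / 2) = expComb (α P.N) (β P.N) t := by
    filter_upwards [P.phiPlus_eventually z, gap_mem_atTop] with t ht ht'
    rw [← ht, h1 _ t ht']
  have hβ : β P.N = 0 := by
    refine eq_zero_of_expComb_bounded (α := α P.N) (C := 1) ?_
    filter_upwards [hev, eventually_ge_atTop 0] with t ht ht'
    rw [← ht, Complex.norm_exp]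
    refine Real.exp_le_one_iff.2 ?_
    simp only [Complex.div_ofNat_re, Complex.neg_re, Complex.ofReal_re]
    linarith
  have hα : α P.N = 1 := by
    obtain ⟨t, ht⟩ := hev.exists
    rw [expComb, hβ, zero_mul, add_zero] at ht
    exact (mul_right_cancel₀ (Complex.exp_ne_zero _) ((one_mul _).trans ht)).symm
  have hco := fun n hn => coeffs_eq (fun n => (h2 n).2) hβ (n := n) hn
  simp only [hα, one_mul] at hco
  refine ⟨fun n hn t ht => ?_, fun n => ?_⟩
  · rw [h1 n t ht, (hco n hn).1, (hco n hn).2]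
  · rw [(h2 n).1, (hco (n + 1) n.2).1, (hco (n + 1) n.2).2]

theorem norm_phiPlus_sq (P : DiscretePair) (z : ℂ) (n : Fin P.N) :
    ‖P.phiPlus z (P.x n)‖ ^ 2 =
      ‖aeval z (P.toKreinString.rnode n)‖ ^ 2 / P.toKreinString.ξ n := by
  have h : P.phiPlus z (P.x n) =
      Complex.exp (-(P.x n : ℂ) / 2) * aeval z (P.toKreinString.rnode n) := by
    rw [(P.phiPlus_coeffs z).2 n, expComb, KreinString.rnode, toKreinString_ξ]
    simp only [map_add, map_mul, aeval_C, Complex.coe_algebraMap, Complex.ofReal_exp]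
    have : Complex.exp ((P.x n : ℂ) / 2) =
        Complex.exp (-(P.x n : ℂ) / 2) * Complex.exp (P.x n : ℂ) := by
      rw [← Complex.exp_add]; congr 1; ring
    rw [this]
    ring
  have h2 : ‖Complex.exp (-(P.x n : ℂ) / 2)‖ ^ 2 = (Real.exp (P.x n))⁻¹ := by
    rw [Complex.norm_exp, ← Real.exp_nat_mul, ← Real.exp_neg]
    simp only [Complex.div_ofNat_re, Complex.neg_re, Complex.ofReal_re]
    congr 1
    push_cast
    ring
  rw [h, norm_mul, mul_pow, h2, toKreinString_ξ]
  ring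

/-- Boundedness at +∞ forces a multiple of φ₊, with factor `α P.N`; boundedness at -∞ forces `α 0`,
which is that factor times χ(z), to vanish. Conversely, at a zero of χ the function φ₊ itself is
bounded. -/
theorem mem_spectrum_iff {z : ℂ} : z ∈ P.spectrum ↔ aeval z P.toKreinString.charPoly = 0 := by
  constructor
  · rintro ⟨f, hf, hf0, C, hC⟩
    obtain ⟨α, β, h1, h2⟩ := hf.exists_coeffs
    have hβ : β P.N = 0 := by
      refine eq_zero_of_expComb_bounded (α := α P.N) (C := C) ?_
      filter_upwards [gap_mem_atTop] with t ht
      rw [← h1 _ t ht]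
      exact hC t
    have hα : α 0 = 0 := by
      refine eq_zero_of_expComb_bounded' (β := β 0) (C := C) ?_
      filter_upwards [gap_mem_atBot] with t ht
      rw [← h1 _ t ht]
      exact hC t
    have hco := fun n hn => coeffs_eq (fun n => (h2 n).2) hβ (n := n) hn
    rw [(hco 0 (Nat.zero_le _)).1] at hα
    refine (mul_eq_zero.1 hα).resolve_left fun hN => hf0 ?_
    simp only [hN, zero_mul] at hco
    funext t
    by_cases ht : ∃ n, P.x n = t
    · obtain ⟨n, rfl⟩ := ht
      rw [(h2 n).1, (hco (n + 1) n.2).1, (hco (n + 1) n.2).2]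
      simp [expComb]
    · push Not at ht
      obtain ⟨n, hn, htn⟩ := exists_mem_gap ht
      rw [h1 n t htn, (hco n hn).1, (hco n hn).2]
      simp [expComb]
  · intro hz
    obtain ⟨h1, -⟩ := P.phiPlus_coeffs z
    refine ⟨P.phiPlus z, P.phiPlus_isSolution z, ?_, ?_⟩
    · intro h0
      obtain ⟨t, ht⟩ := (P.phiPlus_eventually z).exists
      rw [h0] at ht
      exact Complex.exp_ne_zero _ ht.symm
    · obtain ⟨b, hb⟩ := ((P.phiPlus_eventually z).and (eventually_ge_atTop 0)).exists_forall_of_atTop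
      have hbot : ∀ᶠ t in atBot, P.phiPlus z t =
          expComb 0 (aeval z (P.toKreinString.rb 0)) t := by
        filter_upwards [gap_mem_atBot] with t ht
        rw [h1 0 (Nat.zero_le _) t ht]
        congr 1
      obtain ⟨a, ha⟩ := (hbot.and (eventually_le_atBot 0)).exists_forall_of_atBot
      obtain ⟨C, hC⟩ := (isCompact_Icc (a := a) (b := b)).exists_bound_of_continuousOn
        (P.phiPlus_isSolution z).continuous.continuousOn
      refine ⟨max C (max 1 ‖aeval z (P.toKreinString.rb 0)‖), fun t => ?_⟩
      rcases le_total t a with hta | hta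
      · refine le_trans ?_ ((le_max_right _ _).trans (le_max_right _ _))
        rw [(ha t hta).1, expComb, zero_mul, zero_add, norm_mul, Complex.norm_exp]
        refine mul_le_of_le_one_right (norm_nonneg _) (Real.exp_le_one_iff.2 ?_)
        have := (ha t hta).2
        simp only [Complex.div_ofNat_re, Complex.ofReal_re]
        linarith
      · rcases le_total b t with htb | htb
        · refine le_trans ?_ ((le_max_left _ _).trans (le_max_right _ _))
          rw [(hb t htb).1, Complex.norm_exp]
          refine Real.exp_le_one_iff.2 ?_
          have := (hb t htb).2
          simp only [Complex.div_ofNat_re, Complex.neg_re, Complex.ofReal_re]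
          linarith
        · exact (hC t ⟨hta, htb⟩).trans (le_max_left _ _)

end DiscretePair

end PeakonString

/-! ### Spectral theory of the string: real simple eigenvalues and residue sums. -/

namespace KreinString

open Polynomial Hankel

variable {S : KreinString}

theorem aeval_ofReal (l : ℝ) (p : ℝ[X]) : aeval (l : ℂ) p = ((p.eval l : ℝ) : ℂ) := by
  rw [← Complex.coe_algebraMap, aeval_algebraMap_apply, coe_aeval_eq_eval]

theorem charPoly_ne_zero : S.charPoly ≠ 0 := by
  intro h
  have := eval_zero_charPoly (S := S)
  simp [h] at this

theorem aeval_weight (z : ℂ) (n : ℕ) :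
    aeval z (S.weight n) = S.ω n * z + S.υ n * z ^ 2 := by
  simp [weight]

/-- The energy identity reads zW + z²Y = r with W, Y real, Y ≥ 0 and r > 0. If Im z ≠ 0, its
imaginary part gives W = -2Y Re z, and then r = -Y|z|² ≤ 0. -/
theorem im_eq_zero_of_root {z : ℂ} (hz : aeval z S.charPoly = 0) : z.im = 0 := by
  obtain ⟨r, hr, h⟩ := exists_energy hz
  set W := ∑ n ∈ Finset.range S.N, S.ω n * (‖aeval z (S.rnode n)‖ ^ 2 / S.ξ n)
  set Y := ∑ n ∈ Finset.range S.N, S.υ n * (‖aeval z (S.rnode n)‖ ^ 2 / S.ξ n) with hY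
  have hY0 : 0 ≤ Y := Finset.sum_nonneg fun n hn => by
    have hn := Finset.mem_range.1 hn
    exact mul_nonneg (S.υ_nonneg n hn) (div_nonneg (sq_nonneg _) (S.ξ_pos n hn).le)
  have h1 : z * W + z ^ 2 * Y = r := by
    rw [← h]
    simp only [W, Y, Complex.ofReal_sum, Finset.mul_sum, ← Finset.sum_add_distrib]
    refine Finset.sum_congr rfl fun n _ => ?_
    rw [aeval_weight]
    push_cast
    ring
  have hre := congrArg Complex.re h1
  have him := congrArg Complex.im h1
  simp [sq] at hre him
  by_contra hne
  have h2 : W + 2 * z.re * Y = 0 := mul_left_cancel₀ hne (by linarith)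
  have h3 : r = -(Y * (z.re * z.re + z.im * z.im)) := by linear_combination -hre + z.re * h2
  linarith [mul_nonneg hY0 (add_nonneg (mul_self_nonneg z.re) (mul_self_nonneg z.im))]

/-- The norming constant of the right solution. -/
def norming (S : KreinString) (l : ℝ) : ℝ :=
  ∑ n ∈ Finset.range S.N, (S.ω n + 2 * l * S.υ n) * ((S.rnode n).eval l ^ 2 / S.ξ n)

/-- λγ² is the energy plus the nonnegative dipole sum λ²Σ υ|F|²/ξ. -/
theorem norming_pos {l : ℝ} (hl : S.charPoly.eval l = 0) : 0 < l * S.norming l := by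
  obtain ⟨r, hr, h⟩ := exists_energy (S := S) (z := (l : ℂ)) (by rw [aeval_ofReal, hl]; simp)
  have h1 : ∑ n ∈ Finset.range S.N, (S.ω n * l + S.υ n * l ^ 2) *
      ((S.rnode n).eval l ^ 2 / S.ξ n) = r := by
    have : ((∑ n ∈ Finset.range S.N, (S.ω n * l + S.υ n * l ^ 2) *
        ((S.rnode n).eval l ^ 2 / S.ξ n) : ℝ) : ℂ) = r := by
      rw [← h, Complex.ofReal_sum]
      refine Finset.sum_congr rfl fun n _ => ?_
      rw [aeval_weight, aeval_ofReal, Complex.norm_real, Real.norm_eq_abs, sq_abs]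
      push_cast
      ring
    exact_mod_cast this
  have h2 : l * S.norming l = r + ∑ n ∈ Finset.range S.N, S.υ n * l ^ 2 *
      ((S.rnode n).eval l ^ 2 / S.ξ n) := by
    rw [← h1, norming, Finset.mul_sum, ← Finset.sum_add_distrib]
    exact Finset.sum_congr rfl fun n _ => by ring
  rw [h2]
  refine add_pos_of_pos_of_nonneg hr (Finset.sum_nonneg fun n hn => ?_)
  have hn := Finset.mem_range.1 hn
  have := S.υ_nonneg n hn
  have := S.ξ_pos n hn
  positivity

theorem norming_ne {l : ℝ} (hl : S.charPoly.eval l = 0) : S.norming l ≠ 0 :=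
  right_ne_zero_of_mul (norming_pos hl).ne'

theorem norming_eq {l : ℝ} (hl : S.charPoly.eval l = 0) :
    S.norming l = -((derivative S.charPoly).eval l * (S.rb 0).eval l) := by
  have h := congrArg (eval l) (derivative_identity (S := S))
  have hl' : (S.ra 0).eval l = 0 := hl
  rw [eval_sub, eval_mul, eval_mul, hl', zero_mul, zero_sub, eval_finsetSum] at h
  rw [charPoly, h, norming]
  refine Finset.sum_congr rfl fun n _ => ?_
  simp [weight]
  ring

theorem eval_derivative_ne {l : ℝ} (hl : S.charPoly.eval l = 0) :
    (derivative S.charPoly).eval l ≠ 0 := by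
  intro h
  apply norming_ne hl
  rw [norming_eq hl, h]
  simp

/-- The eigenvalues. -/
def eig (S : KreinString) : Finset ℝ := S.charPoly.roots.toFinset

theorem mem_eig {l : ℝ} : l ∈ S.eig ↔ S.charPoly.eval l = 0 := by
  rw [eig, Multiset.mem_toFinset, mem_roots charPoly_ne_zero, IsRoot.def]

theorem image_eig : ((↑) : ℝ → ℂ) '' S.eig = {z : ℂ | aeval z S.charPoly = 0} := by
  ext z
  simp only [Set.mem_image, Finset.mem_coe, mem_eig, Set.mem_ofPred_eq]
  constructor
  · rintro ⟨l, hl, rfl⟩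
    rw [aeval_ofReal, hl, Complex.ofReal_zero]
  · intro hz
    have : ((z.re : ℝ) : ℂ) = z := Complex.ext rfl (im_eq_zero_of_root hz).symm
    refine ⟨z.re, ?_, this⟩
    rw [← this, aeval_ofReal] at hz
    exact_mod_cast hz

theorem nodup_roots_of_forall {F : Type*} [Field F] {p : F[X]} (hp : p ≠ 0)
    (h : ∀ z, p.IsRoot z → ¬(derivative p).IsRoot z) [CharZero F] : p.roots.Nodup := by
  classical
  refine Multiset.nodup_iff_count_le_one.2 fun z => ?_
  rw [count_roots]
  by_contra! hlt
  obtain ⟨h1, h2⟩ := (one_lt_rootMultiplicity_iff_isRoot hp).1 hlt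
  exact h z h1 h2

/-- Over ℂ the polynomial χ splits, and all its roots are real and simple. -/
theorem card_eig : S.eig.card = S.rdeg 0 := by
  have hmap : S.charPoly.map (algebraMap ℝ ℂ) ≠ 0 :=
    (Polynomial.map_ne_zero_iff (algebraMap ℝ ℂ).injective).2 charPoly_ne_zero
  have hnodup : (S.charPoly.map (algebraMap ℝ ℂ)).roots.Nodup := by
    refine nodup_roots_of_forall hmap fun z hz => ?_
    rw [IsRoot.def, eval_map_algebraMap] at hz
    have hz' : z ∈ {z : ℂ | aeval z S.charPoly = 0} := hz
    rw [← image_eig] at hz'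
    obtain ⟨l, hl, rfl⟩ := hz'
    rw [IsRoot.def, derivative_map, eval_map_algebraMap, aeval_ofReal]
    exact_mod_cast eval_derivative_ne (mem_eig.1 hl)
  have h1 : (S.charPoly.map (algebraMap ℝ ℂ)).roots.toFinset = S.eig.image ((↑) : ℝ → ℂ) := by
    apply Finset.coe_injective
    rw [Finset.coe_image, image_eig]
    ext z
    simp [hmap, eval_map_algebraMap]
  rw [← Finset.card_image_of_injective _ Complex.ofReal_injective, ← h1,
    Multiset.toFinset_card_of_nodup hnodup, ← natDegree_charPoly,
    ← natDegree_map (algebraMap ℝ ℂ)]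
  exact (IsAlgClosed.splits _).natDegree_eq_card_roots.symm

theorem charPoly_eq_nodal :
    S.charPoly = C (S.charPoly.coeff (S.rdeg 0)) * Lagrange.nodal S.eig id := by
  have hle : S.eig.card ≤ Multiset.card S.charPoly.roots := Multiset.toFinset_card_le _
  have h1 : Multiset.card S.charPoly.roots = S.charPoly.natDegree :=
    le_antisymm (card_roots' _) (by rwa [natDegree_charPoly, ← card_eig])
  have h2 : S.charPoly.roots.Nodup :=
    nodup_roots_of_forall charPoly_ne_zero fun l hl => eval_derivative_ne hl
  have := C_leadingCoeff_mul_prod_multiset_X_sub_C h1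
  rw [leadingCoeff, natDegree_charPoly] at this
  nth_rewrite 1 [← this]
  rw [Lagrange.nodal, Finset.prod, eig, Multiset.toFinset_val, h2.dedup]
  rfl

/-- The sum is, up to the leading coefficient of χ, the top coefficient of the Lagrange interpolant
of `p` at the eigenvalues, which is `p` itself. -/
theorem sum_div_derivative {p : ℝ[X]} (hp : p.natDegree < S.rdeg 0) :
    ∑ l ∈ S.eig, p.eval l / (derivative S.charPoly).eval l =
      p.coeff (S.rdeg 0 - 1) / S.charPoly.coeff (S.rdeg 0) := by
  have hdeg : p.degree < S.eig.card := by
    rw [card_eig]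
    exact lt_of_le_of_lt degree_le_natDegree (by exact_mod_cast hp)
  rw [← card_eig, Lagrange.coeff_eq_sum (v := id) (Function.injective_id.injOn) hdeg,
    Finset.sum_div]
  refine Finset.sum_congr rfl fun l hl => ?_
  have h1 := Lagrange.eval_nodal_derivative_eval_node_eq (v := id) hl
  rw [Lagrange.eval_nodal] at h1
  rw [charPoly_eq_nodal, derivative_C_mul, eval_C_mul, card_eig, ← charPoly_eq_nodal]
  simp only [id] at h1 ⊢
  rw [h1, div_div, mul_comm]

theorem zero_notMem_eig : (0 : ℝ) ∉ S.eig := by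
  rw [mem_eig, eval_zero_charPoly]
  exact one_ne_zero

theorem sum_div_mul_derivative {p : ℝ[X]} (hp : p.natDegree < S.rdeg 0) :
    ∑ l ∈ S.eig, p.eval l / (l * (derivative S.charPoly).eval l) = -p.eval 0 := by
  -- Since χ(0) = 1, subtracting p(0)χ makes division by X exact without changing values at
  -- eigenvalues, so q(λ) = p(λ)/λ.
  set q : ℝ[X] := divX (p - C (p.eval 0) * S.charPoly) with hq
  have hle : (p - C (p.eval 0) * S.charPoly).natDegree ≤ S.rdeg 0 :=
    (natDegree_sub_le_of_le hp.le ((natDegree_C_mul_le _ _).trans natDegree_charPoly.le)).trans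
      (max_self _).le
  have hqX : q * X = p - C (p.eval 0) * S.charPoly := by
    have h := divX_mul_X_add (p - C (p.eval 0) * S.charPoly)
    have h0 : (p - C (p.eval 0) * S.charPoly).coeff 0 = 0 := by
      simp [coeff_zero_eq_eval_zero, eval_zero_charPoly]
    rwa [h0, C_0, add_zero] at h
  have hqdeg : q.natDegree < S.rdeg 0 := by
    rw [hq, natDegree_divX_eq_natDegree_tsub_one]
    omega
  have hlc : S.charPoly.coeff (S.rdeg 0) ≠ 0 := by
    rw [← natDegree_charPoly]
    exact leadingCoeff_ne_zero.2 charPoly_ne_zero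
  have h1 := sum_div_derivative hqdeg
  have h2 : q.coeff (S.rdeg 0 - 1) = -p.eval 0 * S.charPoly.coeff (S.rdeg 0) := by
    rw [hq, coeff_divX, show S.rdeg 0 - 1 + 1 = S.rdeg 0 by omega, coeff_sub, coeff_C_mul,
      coeff_eq_zero_of_natDegree_lt hp]
    ring
  rw [h2, mul_div_cancel_right₀ _ hlc] at h1
  rw [← h1]
  refine Finset.sum_congr rfl fun l hl => ?_
  have h3 := congrArg (eval l) hqX
  rw [eval_mul, eval_X, eval_sub, eval_C_mul, mem_eig.1 hl, mul_zero, sub_zero] at h3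
  have hl0 : l ≠ 0 := fun h => zero_notMem_eig (h ▸ hl)
  rw [← h3, mul_comm (eval l q), mul_div_mul_left _ _ hl0]

/-- The moments, with the index shifted by one. -/
def mom (S : KreinString) : ℕ → ℝ
  | 0 => 0
  | k + 1 => 0 ^ k + ∑ l ∈ S.eig, (l * S.norming l)⁻¹ * l ^ k

theorem mom_add_two (k : ℕ) : S.mom (k + 2) = ∑ l ∈ S.eig, (S.norming l)⁻¹ * l ^ k := by
  simp only [mom, pow_succ, mul_zero, zero_add]
  refine Finset.sum_congr rfl fun l hl => ?_
  have hl0 : l ≠ 0 := fun h => zero_notMem_eig (h ▸ hl)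
  rw [mul_inv]
  field_simp

/-- The extra 1 in s₀ is a unit point mass at 0, which is not an eigenvalue. So s₀, s₁, … are the
moments of a positive measure with |σ| + 1 atoms. -/
theorem mom_add_one : (fun k => S.mom (k + 1)) = fun k => ∑ l ∈ insert 0 S.eig,
      (if l = 0 then 1 else (l * S.norming l)⁻¹) * l ^ k := by
  funext k
  rw [Finset.sum_insert zero_notMem_eig, if_pos rfl, one_mul, mom]
  congr 1
  refine Finset.sum_congr rfl fun l hl => ?_
  rw [if_neg fun h : l = 0 => zero_notMem_eig (h ▸ hl)]

theorem functional_mom_one (p : ℝ[X]) : functional (fun k => S.mom (k + 1)) p =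
    p.eval 0 + ∑ l ∈ S.eig, p.eval l / (l * S.norming l) := by
  rw [mom_add_one, functional_eq_of_eval _ _ (fun l => l), Finset.sum_insert zero_notMem_eig, if_pos rfl,
    one_mul]
  congr 1
  refine Finset.sum_congr rfl fun l hl => ?_
  rw [if_neg fun h : l = 0 => zero_notMem_eig (h ▸ hl), div_eq_inv_mul]

theorem functional_mom_two (p : ℝ[X]) : functional (fun k => S.mom (k + 2)) p =
    ∑ l ∈ S.eig, p.eval l / S.norming l := by
  simp only [mom_add_two]
  rw [functional_eq_of_eval _ _ (fun l => l)]
  exact Finset.sum_congr rfl fun l _ => (div_eq_inv_mul _ _).symm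

/-! ### Orthogonality relations and Hankel determinants. -/

/-- The Hankel determinants of the moments. -/
def hank (S : KreinString) (j m : ℕ) : ℝ := hdet (fun k => S.mom (k + j)) m

theorem hank_one_pos {m : ℕ} (hm : m ≤ S.rdeg 0 + 1) : 0 < S.hank 1 m := by
  rw [hank, mom_add_one]
  refine hdet_pos _ _ (fun l => l) ?_ (Set.injOn_id _) ?_
  · intro l hl
    split_ifs with h0
    · exact one_pos
    · exact inv_pos.2 (norming_pos (mem_eig.1 ((Finset.mem_insert.1 hl).resolve_left h0)))
  · rwa [Finset.card_insert_of_notMem zero_notMem_eig, card_eig]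

/-- The weights λ/γ² = λγ²/γ⁴ are positive. The weights 1/γ² belonging to `hank 2` have the sign of
λ, so those determinants can vanish. -/
theorem hank_three_pos {m : ℕ} (hm : m ≤ S.rdeg 0) : 0 < S.hank 3 m := by
  have h : (fun k => S.mom (k + 3)) = fun k => ∑ l ∈ S.eig, (l / S.norming l) * l ^ k := by
    funext k
    rw [show k + 3 = (k + 1) + 2 from rfl, mom_add_two]
    exact Finset.sum_congr rfl fun l hl => by ring
  rw [hank, h]
  refine hdet_pos _ _ (fun l => l) (fun l hl => ?_) (Set.injOn_id _) (by rwa [card_eig])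
  have h1 := norming_pos (mem_eig.1 hl)
  have h2 := norming_ne (mem_eig.1 hl)
  have : l / S.norming l = l * S.norming l / S.norming l ^ 2 := by field_simp
  rw [this]
  positivity

/-- Trades the spectral weight of the right solution (`u`) for a residue of the left solution (`v`),
whose degree is small enough for the interpolation sums. -/
theorem div_norming_eq {l : ℝ} (hl : l ∈ S.eig) {u v : ℝ}
    (h : v = (S.lb S.N).eval l * u) :
    u / S.norming l = -(v / (derivative S.charPoly).eval l) := by
  have hl' := mem_eig.1 hl
  have h1 : (S.lb S.N).eval l * (S.rb 0).eval l = 1 := by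
    have := aeval_lb_mul_rb_of_root (S := S) (z := l) (by rwa [coe_aeval_eq_eval])
    simpa [coe_aeval_eq_eval] using this
  have h2 := norming_eq hl'
  have h3 := norming_ne hl'
  have h4 := eval_derivative_ne hl'
  have h5 : (S.rb 0).eval l ≠ 0 := right_ne_zero_of_mul_eq_one h1
  rw [h2, h]
  field_simp
  linear_combination u * h1

theorem eval_lnode_of_mem_eig {l : ℝ} (hl : l ∈ S.eig) {n : ℕ} (hn : n < S.N) :
    (S.lnode n).eval l = (S.lb S.N).eval l * (S.rnode n).eval l := by
  simpa [coe_aeval_eq_eval] using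
    aeval_lnode_of_root (S := S) (z := l) (by rw [coe_aeval_eq_eval, mem_eig.1 hl]) hn

theorem eval_left_of_mem_eig {l : ℝ} (hl : l ∈ S.eig) {n : ℕ} (hn : n ≤ S.N) :
    (S.lb n - S.la n).eval l = (S.lb S.N).eval l * (S.ra n - S.rb n).eval l := by
  have := aeval_left_of_root (S := S) (z := l) (by rw [coe_aeval_eq_eval, mem_eig.1 hl]) hn
  simp only [coe_aeval_eq_eval] at this
  rw [eval_sub, eval_sub, this.1, this.2]
  ring

theorem functional_mom_two_rnode_mul {n : ℕ} (hn : n < S.N) {a : ℕ} (ha : a < S.rdeg n) :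
    functional (fun k => S.mom (k + 2)) (S.rnode n * X ^ a) =
      -((S.lnode n * X ^ a).coeff (S.rdeg 0 - 1) / S.charPoly.coeff (S.rdeg 0)) := by
  have hd := ldeg_add_rdeg (S := S) hn.le
  rw [functional_mom_two, ← sum_div_derivative, ← Finset.sum_neg_distrib]
  · refine Finset.sum_congr rfl fun l hl => div_norming_eq hl ?_
    rw [eval_mul, eval_mul, eval_lnode_of_mem_eig hl hn]
    ring
  · have := natDegree_mul_le_of_le (natDegree_lnode_le hn) (natDegree_X_pow_le (R := ℝ) a)
    omega

theorem functional_rnode_eq_zero {n : ℕ} (hn : n < S.N) {a : ℕ} (ha : a + 1 < S.rdeg n) :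
    functional (fun k => S.mom (k + 2)) (S.rnode n * X ^ a) = 0 := by
  have hd := ldeg_add_rdeg (S := S) hn.le
  rw [functional_mom_two_rnode_mul hn (by omega), coeff_eq_zero_of_natDegree_lt]
  · simp
  · have := natDegree_mul_le_of_le (natDegree_lnode_le hn) (natDegree_X_pow_le (R := ℝ) a)
    omega

theorem functional_rnode_top {n : ℕ} (hn : n < S.N) {a : ℕ} (ha : a + 1 = S.rdeg n) :
    S.lead n * (S.rnode n).coeff (S.rdeg (n + 1)) *
      functional (fun k => S.mom (k + 2)) (S.rnode n * X ^ a) = S.ξ n := by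
  have hd := ldeg_add_rdeg (S := S) hn.le
  have hlc : S.charPoly.coeff (S.rdeg 0) ≠ 0 := by
    rw [← natDegree_charPoly]
    exact leadingCoeff_ne_zero.2 charPoly_ne_zero
  rw [functional_mom_two_rnode_mul hn (by omega), show S.rdeg 0 - 1 = S.ldeg n + a by omega,
    coeff_mul_X_pow]
  have := coeff_charPoly_eq hn
  field_simp
  linarith

theorem functional_mom_one_mul_X_pow_succ (p : ℝ[X]) (a : ℕ) :
    functional (fun k => S.mom (k + 1)) (p * X ^ (a + 1)) =
      functional (fun k => S.mom (k + 2)) (p * X ^ a) := by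
  rw [functional_mul_X_pow, functional_mul_X_pow]
  congr 2

/-- The mass at 0 contributes Fₙ(0) = 1 and the eigenvalues contribute Gₙ(0) = ξₙ. -/
theorem functional_mom_one_rnode {n : ℕ} (hn : n < S.N) :
    functional (fun k => S.mom (k + 1)) (S.rnode n) = 1 + S.ξ n := by
  have hd := ldeg_add_rdeg (S := S) hn.le
  have hd1 := rdeg_of_lt hn
  have hd2 := one_le_deg (S := S) n
  have hdeg := natDegree_lnode_le hn
  have h1 := sum_div_mul_derivative (S := S) (p := S.lnode n) (by omega)
  rw [functional_mom_one, eval_zero_rnode hn, ← eval_zero_lnode, ← neg_neg (eval 0 (S.lnode n)),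
    ← h1, ← Finset.sum_neg_distrib]
  congr 1
  refine Finset.sum_congr rfl fun l hl => ?_
  have := div_norming_eq hl (eval_lnode_of_mem_eig hl hn)
  rw [mul_comm l, mul_comm l, ← div_div, ← div_div, this, neg_div]

/-- The combination `ra - rb` is the continuation to ξ = -1, where the total 1 + ξ of the case a = 0
cancels. For a ≥ 1 the degree of the left factor is too low. -/
theorem functional_mom_one_right {n : ℕ} (hn : n ≤ S.N) {a : ℕ} (ha : a < S.rdeg n) :
    functional (fun k => S.mom (k + 1)) ((S.ra n - S.rb n) * X ^ a) = 0 := by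
  have hd := ldeg_add_rdeg hn
  have hdeg : (S.lb n - S.la n).natDegree ≤ S.ldeg n :=
    (natDegree_sub_le_of_le (left_degree hn).2.1 (left_degree hn).1).trans (max_self _).le
  rcases a with - | a
  · have h1 := sum_div_mul_derivative (S := S) (p := S.lb n - S.la n) (by omega)
    rw [eval_sub, (eval_zero_left n).1, (eval_zero_left n).2] at h1
    rw [pow_zero, mul_one, functional_mom_one, eval_sub, (eval_zero_right hn).1,
      (eval_zero_right hn).2]
    have h2 : ∑ l ∈ S.eig, (S.ra n - S.rb n).eval l / (l * S.norming l) =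
        -∑ l ∈ S.eig, (S.lb n - S.la n).eval l / (l * (derivative S.charPoly).eval l) := by
      rw [← Finset.sum_neg_distrib]
      refine Finset.sum_congr rfl fun l hl => ?_
      have := div_norming_eq hl (eval_left_of_mem_eig hl hn)
      rw [mul_comm l, mul_comm l, ← div_div, ← div_div, this, neg_div]
    rw [h2, h1]
    ring
  · have hdeg' := natDegree_mul_le_of_le hdeg (natDegree_X_pow_le (R := ℝ) a)
    have h1 := sum_div_derivative (S := S) (p := (S.lb n - S.la n) * X ^ a) (by omega)
    rw [coeff_eq_zero_of_natDegree_lt (by omega), zero_div] at h1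
    rw [functional_mom_one_mul_X_pow_succ, functional_mom_two, ← neg_zero, ← h1,
      ← Finset.sum_neg_distrib]
    refine Finset.sum_congr rfl fun l hl => div_norming_eq hl ?_
    rw [eval_mul, eval_mul, eval_left_of_mem_eig hl hn]
    ring

/-! ### Zeros of Δ_{1,m}, the indices κ, and recovery of the weights. -/

theorem rdeg_succ_lt {n : ℕ} (hn : n < S.N) : S.rdeg (n + 1) < S.rdeg n := by
  have := one_le_deg (S := S) n
  rw [rdeg_of_lt hn]
  omega

theorem rdeg_lt_rdeg {m n : ℕ} (h : m < n) (hn : n ≤ S.N) : S.rdeg n < S.rdeg m := by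
  induction n, h using Nat.le_induction with
  | base => exact rdeg_succ_lt hn
  | succ n h ih => exact (rdeg_succ_lt hn).trans (ih (by omega))

theorem rdeg_le_rdeg {m n : ℕ} (h : m ≤ n) (hn : n ≤ S.N) : S.rdeg n ≤ S.rdeg m := by
  rcases h.eq_or_lt with rfl | h
  · exact le_rfl
  · exact (rdeg_lt_rdeg h hn).le

/-- Cramer's rule for Fₙ. At a dipole the range of `m` has two values, and the second one is what
eliminates Δ_{2,k+1} from the formula for υ. -/
theorem hank_one_rdeg {n : ℕ} (hn : n < S.N) {m : ℕ} (hm : S.rdeg (n + 1) ≤ m)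
    (hm' : m < S.rdeg n) : S.hank 1 (m + 1) = (1 + S.ξ n) * S.hank 3 m := by
  have h := coeff_zero_mul_hdet_succ (fun k => S.mom (k + 1)) (p := S.rnode n) (m := m)
    ((natDegree_rnode_le hn).trans hm) ?_
  · rwa [coeff_zero_eq_eval_zero, eval_zero_rnode hn, one_mul, functional_mom_one_rnode hn] at h
  · intro a ha ha'
    obtain ⟨b, rfl⟩ : ∃ b, a = b + 1 := ⟨a - 1, by omega⟩
    rw [functional_mom_one_mul_X_pow_succ, functional_rnode_eq_zero hn (by omega)]

theorem hank_two_succ {n : ℕ} (hn : n < S.N) {m : ℕ} (hm : S.rdeg (n + 1) ≤ m)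
    (hm' : m < S.rdeg n) : S.hank 2 (m + 1) =
      (-1) ^ m * functional (fun k => S.mom (k + 2)) (S.rnode n * X ^ m) * S.hank 3 m := by
  have h := coeff_zero_mul_hdet_succ_of_orthogonal (fun k => S.mom (k + 2)) (p := S.rnode n)
    (m := m) ((natDegree_rnode_le hn).trans hm)
    fun a ha => functional_rnode_eq_zero hn (by omega)
  rwa [coeff_zero_eq_eval_zero, eval_zero_rnode hn, one_mul] at h

theorem coeff_rnode_mul_hank {n : ℕ} (hn : n < S.N) :
    (S.rnode n).coeff (S.rdeg (n + 1)) * S.hank 3 (S.rdeg (n + 1)) =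
      (-1) ^ S.rdeg (n + 1) * S.hank 2 (S.rdeg (n + 1)) := by
  have hlt := rdeg_succ_lt hn
  have h := coeff_mul_hdet_shift (fun k => S.mom (k + 2)) (p := S.rnode n)
    (natDegree_rnode_le hn) fun a ha => functional_rnode_eq_zero hn (by omega)
  rwa [coeff_zero_eq_eval_zero, eval_zero_rnode hn, mul_one] at h

theorem hank_two_rdeg_ne {n : ℕ} (hn : n ≤ S.N) : S.hank 2 (S.rdeg n) ≠ 0 := by
  rcases hn.eq_or_lt with rfl | hn
  · rw [rdeg_N, hank, hdet, Matrix.det_fin_zero]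
    exact one_ne_zero
  · have hlt := rdeg_succ_lt hn
    obtain ⟨m, hm⟩ : ∃ m, m + 1 = S.rdeg n := ⟨S.rdeg n - 1, by omega⟩
    have h1 := functional_rnode_top hn hm
    have h2 := right_ne_zero_of_mul (h1.trans_ne (S.ξ_pos n hn).ne')
    have h3 := rdeg_le_rdeg (S := S) (Nat.zero_le n) hn.le
    rw [← hm, hank_two_succ hn (by omega) (by omega)]
    exact mul_ne_zero (mul_ne_zero (pow_ne_zero _ (by norm_num)) h2)
      (hank_three_pos (by omega)).ne'

theorem hank_two_eq_zero {n : ℕ} (hn : n < S.N) {m : ℕ} (hm : S.rdeg (n + 1) < m)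
    (hm' : m < S.rdeg n) : S.hank 2 m = 0 := by
  obtain ⟨k, rfl⟩ : ∃ k, m = k + 1 := ⟨m - 1, by omega⟩
  rw [hank_two_succ hn (by omega) (by omega), functional_rnode_eq_zero hn (by omega)]
  simp

/-- The degrees partition the range up to `rdeg n` into blocks, and `hank 2` vanishes strictly
inside each block. -/
theorem exists_rdeg_eq {n m : ℕ} (hn : n ≤ S.N) (hm : m ≤ S.rdeg n) (h0 : S.hank 2 m ≠ 0) :
    ∃ k ≤ S.N, S.rdeg k = m := by
  revert hm
  refine right_induction (motive := fun n => m ≤ S.rdeg n → ∃ k ≤ S.N, S.rdeg k = m) ?_ ?_ hn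
  · intro hm
    rw [rdeg_N] at hm
    exact ⟨S.N, le_rfl, by rw [rdeg_N]; omega⟩
  · intro n hn ih hm
    rcases Nat.lt_or_ge (S.rdeg (n + 1)) m with h | h
    · rcases hm.eq_or_lt with rfl | hm
      · exact ⟨n, hn.le, rfl⟩
      · exact absurd (hank_two_eq_zero hn h hm) h0
    · exact ih h

theorem hank_two_ne_zero_iff {m : ℕ} (hm : m ≤ S.rdeg 0) :
    S.hank 2 m ≠ 0 ↔ ∃ k ≤ S.N, S.rdeg k = m := by
  constructor
  · exact exists_rdeg_eq (Nat.zero_le _) hm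
  · rintro ⟨k, hk, rfl⟩
    exact hank_two_rdeg_ne hk

open Classical in
theorem filter_hank_two_ne (k : ℕ) :
    (Finset.Icc k (S.rdeg 0)).filter (fun j => S.hank 2 j ≠ 0) =
      ((Finset.range (S.N + 1)).filter fun n => k ≤ S.rdeg n).image S.rdeg := by
  ext j
  simp only [Finset.mem_filter, Finset.mem_Icc, Finset.mem_image, Finset.mem_range]
  constructor
  · rintro ⟨⟨h1, h2⟩, h3⟩
    obtain ⟨n, hn, rfl⟩ := (hank_two_ne_zero_iff h2).1 h3
    exact ⟨n, ⟨by omega, h1⟩, rfl⟩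
  · rintro ⟨n, ⟨h1, h2⟩, rfl⟩
    exact ⟨⟨h2, rdeg_le_rdeg (Nat.zero_le _) (by omega)⟩, hank_two_rdeg_ne (by omega)⟩

theorem rdeg_injOn : Set.InjOn S.rdeg (Set.Iic S.N) := by
  intro m hm n hn h
  rcases lt_trichotomy m n with hlt | rfl | hlt
  · exact absurd h (rdeg_lt_rdeg hlt hn).ne'
  · rfl
  · exact absurd h (rdeg_lt_rdeg hlt hm).ne

open Classical in
theorem card_filter_hank_two_ne (k : ℕ) :
    ((Finset.Icc k (S.rdeg 0)).filter (fun j => S.hank 2 j ≠ 0)).card =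
      ((Finset.range (S.N + 1)).filter fun n => k ≤ S.rdeg n).card := by
  rw [filter_hank_two_ne, Finset.card_image_of_injOn]
  refine rdeg_injOn.mono fun n hn => ?_
  have := (Finset.mem_filter.1 (Finset.mem_coe.1 hn)).1
  exact Nat.lt_succ_iff.1 (Finset.mem_range.1 this)

open Classical in
theorem card_filter_hank_two_eq_zero :
    ((Finset.Icc 1 (S.rdeg 0)).filter fun j => S.hank 2 j = 0).card + S.N = S.rdeg 0 := by
  have h1 := Finset.card_filter_add_card_filter_not (s := Finset.Icc 1 (S.rdeg 0))
    (fun j => S.hank 2 j = 0)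
  have h2 := card_filter_hank_two_ne (S := S) 1
  have h3 : (Finset.range (S.N + 1)).filter (fun n => 1 ≤ S.rdeg n) = Finset.range S.N := by
    ext n
    simp only [Finset.mem_filter, Finset.mem_range]
    constructor
    · rintro ⟨h4, h5⟩
      refine lt_of_le_of_ne (Nat.lt_succ_iff.1 h4) ?_
      rintro rfl
      rw [rdeg_N] at h5
      omega
    · intro h
      have := rdeg_lt_rdeg h le_rfl
      exact ⟨by omega, by omega⟩
  rw [h3, Finset.card_range] at h2
  rw [Nat.card_Icc, Nat.add_sub_cancel] at h1
  rw [← h2]; exact h1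

open Classical in
-- The count at k is the number of indices j ≤ N with `rdeg j ≥ k`. As `rdeg` strictly decreases,
-- the count is n + 1 at `rdeg n` and at most n beyond it.
theorem findGreatest_eq_rdeg {n : ℕ} (hn : n ≤ S.N) :
    Nat.findGreatest (fun k =>
      ((Finset.Icc k (S.rdeg 0)).filter fun j => S.hank 2 j ≠ 0).card = n + 1) (S.rdeg 0) =
      S.rdeg n := by
  rw [Nat.findGreatest_eq_iff]
  refine ⟨rdeg_le_rdeg (Nat.zero_le _) hn, fun _ => ?_, fun k hk _ h => ?_⟩
  · rw [card_filter_hank_two_ne]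
    have : (Finset.range (S.N + 1)).filter (fun m => S.rdeg n ≤ S.rdeg m) =
        Finset.range (n + 1) := by
      ext m
      simp only [Finset.mem_filter, Finset.mem_range]
      constructor
      · rintro ⟨h1, h2⟩
        by_contra! h3
        have := rdeg_lt_rdeg (S := S) (m := n) (n := m) (by omega) (by omega)
        omega
      · intro h
        exact ⟨by omega, rdeg_le_rdeg (by omega) hn⟩
    rw [this, Finset.card_range]
  · rw [card_filter_hank_two_ne] at h
    have : (Finset.range (S.N + 1)).filter (fun m => k ≤ S.rdeg m) ⊆ Finset.range n := by
      intro m hm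
      obtain ⟨h1, h2⟩ := Finset.mem_filter.1 hm
      rw [Finset.mem_range] at h1 ⊢
      by_contra! h3
      have := rdeg_le_rdeg (S := S) (m := n) (n := m) h3 (by omega)
      omega
    have := Finset.card_le_card this
    rw [Finset.card_range] at this
    omega

theorem υ_eq_zero_of_hank_ne {n : ℕ} (hn : n < S.N) (h : S.hank 2 (S.rdeg (n + 1) + 1) ≠ 0) :
    S.υ n = 0 := by
  by_contra h0
  refine h (hank_two_eq_zero hn (Nat.lt_succ_self _) ?_)
  rw [rdeg_of_lt hn, deg, if_neg h0]
  omega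

theorem υ_ne_zero_of_hank_eq {n : ℕ} (hn : n < S.N) (h : S.hank 2 (S.rdeg (n + 1) + 1) = 0) :
    S.υ n ≠ 0 := by
  intro h0
  refine hank_two_rdeg_ne hn.le ?_
  rwa [rdeg_of_lt hn, deg, if_pos h0, add_comm]

/-- Both factors accompanying `lead n` in `functional_rnode_top` are ratios of Hankel determinants:
the top coefficient of Fₙ by `coeff_rnode_mul_hank`, the functional by `hank_two_succ`. -/
theorem lead_eq {n : ℕ} (hn : n < S.N) {m : ℕ} (hm : m + 1 = S.rdeg n) :
    S.lead n * S.hank 2 (S.rdeg (n + 1)) * S.hank 2 (m + 1) =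
      (-1) ^ (S.rdeg (n + 1) + m) * S.ξ n * S.hank 3 (S.rdeg (n + 1)) * S.hank 3 m := by
  have hlt := rdeg_succ_lt hn
  have h1 := functional_rnode_top hn hm
  have h2 := coeff_rnode_mul_hank hn
  have h3 := hank_two_succ hn (m := m) (by omega) (by omega)
  have h4 : ((-1 : ℝ) ^ S.rdeg (n + 1)) * (-1) ^ S.rdeg (n + 1) = 1 := by
    rw [← mul_pow]; simp
  rw [h3, ← h1, pow_add]
  linear_combination (-(-1) ^ S.rdeg (n + 1) * S.lead n * (-1) ^ m *
    functional (fun k => S.mom (k + 2)) (S.rnode n * X ^ m) * S.hank 3 m) * h2 -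
    (S.lead n * S.hank 2 (S.rdeg (n + 1)) * (-1) ^ m *
    functional (fun k => S.mom (k + 2)) (S.rnode n * X ^ m) * S.hank 3 m) * h4

theorem hank_zero_rdeg {n : ℕ} (hn : n ≤ S.N) : S.hank 0 (S.rdeg n + 1) =
    functional S.mom (S.ra n - S.rb n) * S.hank 2 (S.rdeg n) := by
  have hdeg := (natDegree_sub_le_of_le (right_degree hn).1 (right_degree hn).2.1).trans
    (max_self _).le
  have h := coeff_zero_mul_hdet_succ S.mom (p := S.ra n - S.rb n) hdeg ?_
  · rwa [coeff_zero_eq_eval_zero, eval_sub, (eval_zero_right hn).1, (eval_zero_right hn).2,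
      sub_zero, one_mul] at h
  · intro a ha ha'
    obtain ⟨b, rfl⟩ : ∃ b, a = b + 1 := ⟨a - 1, by omega⟩
    have := functional_mom_one_right hn (a := b) (by omega)
    rw [functional_mul_X_pow] at this ⊢
    rw [← this]
    congr 2

/-- The jump of `ra - rb` is (1 + 1/ξₙ)(ωₙX + υₙX²)Fₙ. At a dipole the functional annihilates X²Fₙ,
which isolates ωₙ. -/
theorem functional_mom_sub {n : ℕ} (hn : n < S.N) (h0 : S.υ n ≠ 0) :
    functional S.mom (S.ra (n + 1) - S.rb (n + 1)) - functional S.mom (S.ra n - S.rb n) =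
      S.ω n * (1 + S.ξ n) * (1 + (S.ξ n)⁻¹) := by
  have h1 : (S.ra (n + 1) - S.rb (n + 1)) - (S.ra n - S.rb n) =
      (S.ω n * (1 + (S.ξ n)⁻¹)) • (S.rnode n * X ^ 1) +
        (S.υ n * (1 + (S.ξ n)⁻¹)) • (S.rnode n * X ^ 2) := by
    rw [ra_of_lt hn, rb_of_lt hn, weight]
    simp only [smul_eq_C_mul, C_mul, C_add, C_1]
    ring
  have h2 : functional S.mom (S.rnode n * X ^ 1) = 1 + S.ξ n := by
    rw [← functional_mom_one_rnode hn, functional_mul_X_pow]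
  have h3 : functional S.mom (S.rnode n * X ^ 2) = 0 := by
    rw [functional_mul_X_pow]
    have h4 := functional_rnode_eq_zero hn (a := 0) (by rw [rdeg_of_lt hn, deg, if_neg h0]; omega)
    rwa [pow_zero, mul_one] at h4
  rw [← map_sub, h1, map_add, map_smul, map_smul, h2, h3]
  simp only [smul_eq_mul]
  ring

end KreinString

/-! ### Transfer of spectrum, norming constants and moments to the original data. -/

namespace PeakonString

namespace DiscretePair

open Polynomial KreinString

variable {P : DiscretePair}

theorem spectrum_eq_image : P.spectrum = ((↑) : ℝ → ℂ) '' P.toKreinString.eig := by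
  rw [image_eig]
  ext z
  exact mem_spectrum_iff

theorem ofReal_mem_spectrum {l : ℝ} : (l : ℂ) ∈ P.spectrum ↔ l ∈ P.toKreinString.eig := by
  rw [spectrum_eq_image]
  simp

theorem numEigenvalues_eq : P.numEigenvalues = P.toKreinString.rdeg 0 := by
  rw [numEigenvalues, spectrum_eq_image, Set.ncard_image_of_injective _ Complex.ofReal_injective,
    Set.ncard_coe_finset, card_eig]

theorem gammaSq_eq (l : ℝ) : P.gammaSq l = P.toKreinString.norming l := by
  have h : ∀ n : Fin P.N, ‖P.phiPlus l (P.x n)‖ ^ 2 =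
      (P.toKreinString.rnode n).eval l ^ 2 / P.toKreinString.ξ n := fun n => by
    rw [norm_phiPlus_sq, aeval_ofReal, Complex.norm_real, Real.norm_eq_abs, sq_abs]
  rw [gammaSq, integralω, integralυ, norming, Finset.mul_sum, ← Finset.sum_add_distrib]
  refine Eq.trans ?_ (Fin.sum_univ_eq_sum_range (fun n => (P.toKreinString.ω n +
    2 * l * P.toKreinString.υ n) * ((P.toKreinString.rnode n).eval l ^ 2 / P.toKreinString.ξ n)) _)
  refine Finset.sum_congr rfl fun n _ => ?_
  rw [h, toKreinString_ω, toKreinString_υ]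
  ring

theorem spectralSum_eq (k : ℕ) : P.spectralSum k =
    ∑ l ∈ P.toKreinString.eig, (l * P.toKreinString.norming l)⁻¹ * l ^ k := by
  simp only [spectralSum, ofReal_mem_spectrum]
  rw [finsum_mem_finset_eq_sum]
  exact Finset.sum_congr rfl fun l _ => by rw [gammaSq_eq, div_eq_inv_mul]

theorem moment_eq (k : ℕ) : P.moment ((k : ℤ) - 1) = P.toKreinString.mom k := by
  rcases k with - | - | k
  · simp [moment, mom]
  · simp [moment, mom, spectralSum_eq]
  · have h1 : ((k + 1 + 1 : ℕ) : ℤ) - 1 = ((k + 1 : ℕ) : ℤ) := by push_cast; ring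
    rw [h1, moment, if_neg (by omega), if_neg (by omega), Int.toNat_natCast, spectralSum_eq, mom]
    simp

theorem hankelDet_eq (j k : ℕ) : P.hankelDet ((j : ℤ) - 1) k = P.toKreinString.hank j k := by
  rw [hankelDet, hank, Hankel.hdet]
  congr 1
  ext a b
  simp only [Matrix.of_apply, Hankel.mat]
  rw [← moment_eq]
  congr 1
  push_cast
  ring

end DiscretePair

end PeakonString

end

theorem mainTheorem4 (P : PeakonString.DiscretePair) :
    -- the spectral data are well defined: the spectrum is finite and real, all `l γ_l²` are positive
    P.spectrum.Finite ∧
    (∀ z ∈ P.spectrum, z.im = 0) ∧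
    (∀ l : ℝ, (l : ℂ) ∈ P.spectrum → 0 < l * P.gammaSq l) ∧
    -- `N = |σ| - κ₀`
    P.kappaZero ≤ P.numEigenvalues ∧
    P.N = P.numEigenvalues - P.kappaZero ∧
    -- the index `n ∈ {1, …, N}` of the text is `(i : ℕ) + 1`, and `k` is `κ(n)`
    ∀ (i : Fin P.N) (k : ℕ), k = P.kappa ((i : ℕ) + 1) →
      -- the right-hand sides below are meaningful
      0 < P.hankelDet 0 (k + 1) ∧ 0 < P.hankelDet 2 k ∧
      0 < P.hankelDet 0 (k + 1) / P.hankelDet 2 k - 1 ∧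
      P.hankelDet 1 k ≠ 0 ∧
      -- the positions
      P.x i = Real.log (P.hankelDet 0 (k + 1) / P.hankelDet 2 k - 1) ∧
      -- the weights
      (P.hankelDet 1 (k + 1) ≠ 0 →
        P.ω i = P.hankelDet 2 k * (P.hankelDet 0 (k + 1) - P.hankelDet 2 k) /
            (P.hankelDet 1 k * P.hankelDet 1 (k + 1)) ∧
        P.υ i = 0) ∧
      (P.hankelDet 1 (k + 1) = 0 →
        P.hankelDet 1 (k + 2) ≠ 0 ∧
        P.ω i = P.hankelDet 2 k * (P.hankelDet 0 (k + 1) - P.hankelDet 2 k) /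
            P.hankelDet 0 (k + 1) ^ 2 *
            (P.hankelDet (-1) (k + 1) / P.hankelDet 1 k -
              P.hankelDet (-1) (k + 3) / P.hankelDet 1 (k + 2)) ∧
        P.υ i = -(P.hankelDet 0 (k + 2) / P.hankelDet 0 (k + 1)) *
            (P.hankelDet 2 k * (P.hankelDet 0 (k + 1) - P.hankelDet 2 k) /
              (P.hankelDet 1 k * P.hankelDet 1 (k + 2)))) := by
  classical
  have e1 : ∀ k, P.hankelDet 1 k = P.toKreinString.hank 2 k :=
    PeakonString.DiscretePair.hankelDet_eq 2
  have e0 : ∀ k, P.hankelDet 0 k = P.toKreinString.hank 1 k :=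
    PeakonString.DiscretePair.hankelDet_eq 1
  have e2 : ∀ k, P.hankelDet 2 k = P.toKreinString.hank 3 k :=
    PeakonString.DiscretePair.hankelDet_eq 3
  have e3 : ∀ k, P.hankelDet (-1) k = P.toKreinString.hank 0 k :=
    PeakonString.DiscretePair.hankelDet_eq 0
  have hκ : P.kappaZero + P.N = P.numEigenvalues := by
    simp only [PeakonString.DiscretePair.kappaZero, e1, PeakonString.DiscretePair.numEigenvalues_eq]
    convert KreinString.card_filter_hank_two_eq_zero (S := P.toKreinString)
    rfl
  refine ⟨?_, ?_, ?_, by omega, by omega, ?_⟩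
  · rw [PeakonString.DiscretePair.spectrum_eq_image]
    exact (Finset.finite_toSet _).image _
  · intro z hz
    exact KreinString.im_eq_zero_of_root (PeakonString.DiscretePair.mem_spectrum_iff.1 hz)
  · intro l hl
    rw [PeakonString.DiscretePair.gammaSq_eq]
    exact KreinString.norming_pos
      (KreinString.mem_eig.1 (PeakonString.DiscretePair.ofReal_mem_spectrum.1 hl))
  intro i k hk
  have hkr : k = P.toKreinString.rdeg (i + 1) := by
    rw [hk]
    simp only [PeakonString.DiscretePair.kappa, e1,
      PeakonString.DiscretePair.numEigenvalues_eq]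
    convert KreinString.findGreatest_eq_rdeg (S := P.toKreinString) (n := i + 1) i.2
  have hN : (i : ℕ) < P.toKreinString.N := i.2
  simp only [e0, e1, e2, e3]
  rw [hkr, ← PeakonString.DiscretePair.toKreinString_ω, ← PeakonString.DiscretePair.toKreinString_υ]
  have hx := PeakonString.DiscretePair.toKreinString_ξ P i
  -- From here on only the string matters; `hx` keeps the relation ξ = exp x.
  generalize P.toKreinString = S at *
  generalize (i : ℕ) = n at *
  have hlt := KreinString.rdeg_succ_lt hN
  have hle := KreinString.rdeg_le_rdeg (S := S) (Nat.zero_le n) hN.le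
  have hξ := S.ξ_pos n hN
  have p0 := KreinString.hank_one_pos (S := S) (m := S.rdeg (n + 1) + 1) (by omega)
  have p2 := KreinString.hank_three_pos (S := S) (m := S.rdeg (n + 1)) (by omega)
  have n1 := KreinString.hank_two_rdeg_ne (S := S) (n := n + 1) hN
  have h02 := KreinString.hank_one_rdeg hN le_rfl hlt
  have hdiv : S.hank 1 (S.rdeg (n + 1) + 1) / S.hank 3 (S.rdeg (n + 1)) - 1 = S.ξ n := by
    rw [h02]; field_simp; ring
  have hsub : S.hank 1 (S.rdeg (n + 1) + 1) - S.hank 3 (S.rdeg (n + 1)) =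
      S.ξ n * S.hank 3 (S.rdeg (n + 1)) := by
    rw [h02]; ring
  refine ⟨p0, p2, by rwa [hdiv], n1, ?_, ?_, ?_⟩
  · rw [hdiv, hx, Real.log_exp]
  · intro hne
    have hυ := KreinString.υ_eq_zero_of_hank_ne hN hne
    refine ⟨?_, hυ⟩
    have hd : S.rdeg (n + 1) + 1 = S.rdeg n := by
      rw [KreinString.rdeg_of_lt hN, KreinString.deg, if_pos hυ, add_comm]
    have hl := KreinString.lead_eq hN hd
    rw [KreinString.lead, if_pos hυ, ← two_mul, Even.neg_one_pow (even_two_mul _)] at hl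
    rw [hsub]
    field_simp
    linarith
  · intro h0
    have hυ := KreinString.υ_ne_zero_of_hank_eq hN h0
    have hd : S.rdeg (n + 1) + 2 = S.rdeg n := by
      rw [KreinString.rdeg_of_lt hN, KreinString.deg, if_neg hυ, add_comm]
    have n2 : S.hank 2 (S.rdeg (n + 1) + 2) ≠ 0 := hd ▸ KreinString.hank_two_rdeg_ne hN.le
    refine ⟨n2, ?_, ?_⟩
    -- As `rdeg n` = k + 2, the two ratios are the functional of `ra - rb` right and left of the
    -- point. Their difference is ωₙ(1 + ξₙ)²/ξₙ, and the prefactor is ξₙ/(1 + ξₙ)².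
    · have f1 := KreinString.hank_zero_rdeg (S := S) (n := n + 1) hN
      have f2 := KreinString.hank_zero_rdeg (S := S) (n := n) hN.le
      have f3 := KreinString.functional_mom_sub hN hυ
      rw [← hd] at f2
      rw [f1, f2, hsub, mul_div_cancel_right₀ _ n1, mul_div_cancel_right₀ _ n2, f3, h02]
      field_simp
      ring
    -- The sign exponent k + (k + 1) is odd, whence the minus sign. The common factor 1 + ξₙ turns
    -- Δ_{2,k+1}/Δ_{2,k} into Δ_{0,k+2}/Δ_{0,k+1}.
    · have hl := KreinString.lead_eq hN (m := S.rdeg (n + 1) + 1) (by omega)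
      have h02' := KreinString.hank_one_rdeg hN (m := S.rdeg (n + 1) + 1) (by omega) (by omega)
      rw [KreinString.lead, if_neg hυ, ← add_assoc, ← two_mul,
        Odd.neg_one_pow (odd_two_mul_add_one _)] at hl
      rw [hsub, h02, h02']
      field_simp
      linarith
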